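/- Let $\Gamma$ be a finite group with set of conjugacy classes $\Gamma_*$, let $c^0\in\Gamma_*$ be the class of the identity, and let $\Gamma_n=\Gamma^n\rtimes S_n$ ($n\ge 0$) be the wreath product, with $(g,\sigma)(h,\tau)=(g\,\sigma(h),\sigma\tau)$ and $\sigma(h)_i=h_{\sigma^{-1}(i)}$. Let $\mathcal P(\Gamma_*)$ be the set of partition-valued functions on $\Gamma_*$; for $\rho\in\mathcal P(\Gamma_*)$ put $\|\rho\|=\sum_{c}|\rho(c)|$. The type of $x=(g,\sigma)\in\Gamma_n$ is the function $\rho\in\mathcal P(\Gamma_*)$ for which the parts of $\rho(c)$ are the lengths of the cycles $(i_1\,i_2\cdots i_k)$ of $\sigma$ (fixed points included) whose cycle-product $g_{i_k}\cdots g_{i_1}$ lies in $c$. The modified type of $x$ is obtained from $\rho$ by diminishing every part of $\rho(c^0)$ by $1$ and dropping the resulting zeros. Let $R_{\mathbb Z}(\Gamma_n)$ be the center of $\mathbb Z[\Gamma_n]$, and for $\mu\in\mathcal P(\Gamma_*)$ let $K_\mu(n)\in R_{\mathbb Z}(\Gamma_n)$ be the sum of all elements of $\Gamma_n$ of modified type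 $\mu$. Let $R\subset\mathbb Q[t]$ be the ring of polynomials that take integer values at all integers. (1) For every $n$ the subgroups of $R_{\mathbb Z}(\Gamma_n)$ spanned by $\{K_\mu(n):\|\mu\|\le d\}$, $d\ge0$, form a ring filtration. Let $\mathcal G_\Gamma(n)$ be the associated graded ring, and write $K_\mu(n)$ also for the class of $K_\mu(n)$ in its component of degree $\|\mu\|$. Then $K_\mu(n)=0$ if $\|\mu\|+\ell(\mu(c^0))>n$, the classes $K_\mu(n)$ with $\|\mu\|+\ell(\mu(c^0))\le n$ form a $\mathbb Z$-basis of $\mathcal G_\Gamma(n)$, and there are non-negative integers $a_{\lambda\mu}^\nu$, independent of $n$, such that for all $n$ and all $\lambda,\mu\in\mathcal P(\Gamma_*)$, in $\mathcal G_\Gamma(n)$, $$K_\lambda(n)K_\mu(n)=\sum_{\|\nu\|=\|\lambda\|+\|\mu\|}a_{\lambda\mu}^\nu K_\nu(n).$$ (2) There is a unique family of elements $f_{\lambda\mu}^\nu\in R$ (for fixed $\lambda,\mu$ almost all of them zero) such that $K_\lambda(n)K_\mu(n)=\sum_\nu f_{\lambda\mu}^\nu(n)K_\nu(n)$ in $R_{\mathbb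 Z}(\Gamma_n)$ for all $n,\lambda,\mu$. One has $f_{\lambda\mu}^\nu=0$ if $\|\nu\|>\|\lambda\|+\|\mu\|$, and $f_{\lambda\mu}^\nu=a_{\lambda\mu}^\nu$ is constant if $\|\nu\|=\|\lambda\|+\|\mu\|$. (3) There is a commutative ring $\mathcal G_\Gamma$ (the Farahat–Higman ring) with $\mathbb Z$-basis $(K_\lambda)_{\lambda\in\mathcal P(\Gamma_*)}$ and multiplication $K_\lambda K_\mu=\sum_{\|\nu\|=\|\lambda\|+\|\mu\|}a_{\lambda\mu}^\nu K_\nu$, and there is a commutative $R$-algebra $\mathcal F_\Gamma$ with $R$-basis $(K_\lambda)_{\lambda\in\mathcal P(\Gamma_*)}$ and multiplication $K_\lambda K_\mu=\sum_\nu f_{\lambda\mu}^\nu K_\nu$. (4) The $R$-submodules of $\mathcal F_\Gamma$ spanned by $\{K_\lambda:\|\lambda\|\le d\}$, $d\ge0$, form a ring filtration, and its associated graded ring is isomorphic, as a graded $R$-algebra, to $R\otimes_{\mathbb Z}\mathcal G_\Gamma$ (where $1\otimes K_\lambda$ has degree $\|\lambda\|$); the isomorphism sends the class of $K_\lambda$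 in degree $\|\lambda\|$ to $1\otimes K_\lambda$. -/

import Mathlib

open scoped DirectSum TensorProduct Polynomial

universe u v w

noncomputable section

namespace FarahatHigman

/-! ### The graded ring associated to a filtered commutative algebra -/

section AssociatedGraded

variable {S A : Type*} [CommRing S] [CommRing A] [Algebra S A]

/-- The part of degree `< d` of an increasing filtration `F 0 ≤ F 1 ≤ ...`. -/
def filLT (F : ℕ → Submodule S A) (d : ℕ) : Submodule S A := ⨆ i, ⨆ _ : i < d, F i

/-- The quotient `F d / F (d - 1)`, where `F (-1) = 0`. -/
def GrPiece (F : ℕ → Submodule S A) (d : ℕ) : Type _ :=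
  (F d) ⧸ ((filLT F d).submoduleOf (F d))

instance (F : ℕ → Submodule S A) (d : ℕ) : AddCommGroup (GrPiece F d) :=
  inferInstanceAs (AddCommGroup ((F d) ⧸ ((filLT F d).submoduleOf (F d))))

instance (F : ℕ → Submodule S A) (d : ℕ) : Module S (GrPiece F d) :=
  inferInstanceAs (Module S ((F d) ⧸ ((filLT F d).submoduleOf (F d))))

/-- The projection `F d → F d / F (d - 1)`. -/
def grMk (F : ℕ → Submodule S A) (d : ℕ) : (F d) →ₗ[S] GrPiece F d :=
  ((filLT F d).submoduleOf (F d)).mkQ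

theorem grMk_surjective (F : ℕ → Submodule S A) (d : ℕ) : Function.Surjective (grMk F d) :=
  Submodule.mkQ_surjective _

theorem grMk_eq_zero (F : ℕ → Submodule S A) (d : ℕ) (a : F d) :
    grMk F d a = 0 ↔ (a : A) ∈ filLT F d :=
  (Submodule.Quotient.mk_eq_zero ((filLT F d).submoduleOf (F d))).trans Submodule.mem_comap

/-- The graded ring `⨁ d, F d / F (d - 1)` associated to the filtration `F`. -/
abbrev AssocGr (F : ℕ → Submodule S A) : Type _ := ⨁ d, GrPiece F d

variable (F : ℕ → Submodule S A)

theorem gradedMonoid_ext {i j : ℕ} (h : i = j) (a : F i) (b : F j) (hab : (a : A) = b) :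
    (GradedMonoid.mk i (grMk F i a) : GradedMonoid (GrPiece F)) =
      GradedMonoid.mk j (grMk F j b) := by
  subst h
  rw [Subtype.ext hab]

section Ring

variable [hF : IsRingFiltration F (filLT F)]

theorem filLT_mul_mem {i j : ℕ} {a b : A} (ha : a ∈ filLT F i) (hb : b ∈ F j) :
    a * b ∈ filLT F (i + j) := by
  have h : filLT F i ≤ (filLT F (i + j)).comap (LinearMap.mulRight S b) := by
    refine iSup₂_le fun k hk x hx => ?_
    have h1 : x * b ∈ F (k + j) := SetLike.mul_mem_graded hx hb
    exact hF.is_le (by omega : k + j < i + j) h1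
  exact h ha

/-- Multiplication `F i × F j → F (i + j)`, followed by the projection. -/
def mulAux (i j : ℕ) : F i →ₗ[S] F j →ₗ[S] GrPiece F (i + j) :=
  LinearMap.mk₂ S (fun a b => grMk F (i + j) ⟨a * b, SetLike.mul_mem_graded a.2 b.2⟩)
    (fun a a' b => by
      rw [← map_add]; congr 1; ext; simp [add_mul])
    (fun c a b => by
      rw [← map_smul]; congr 1; ext; simp)
    (fun a b b' => by
      rw [← map_add]; congr 1; ext; simp [mul_add])
    (fun c a b => by
      rw [← map_smul]; congr 1; ext; simp)

/-- The product `[a] * [b] = [a * b]` on the graded pieces. -/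
def grMul (i j : ℕ) : GrPiece F i →ₗ[S] GrPiece F j →ₗ[S] GrPiece F (i + j) :=
  Submodule.liftQ _
    (LinearMap.flip (Submodule.liftQ _ (LinearMap.flip (mulAux F i j)) (by
      intro b hb
      rw [LinearMap.mem_ker]
      ext a
      refine (grMk_eq_zero F _ _).2 ?_
      have hb' : (b : A) ∈ filLT F j := hb
      have := filLT_mul_mem F hb' a.2
      rw [add_comm j i, mul_comm] at this
      exact this)))
    (by
      intro a ha
      rw [LinearMap.mem_ker]
      ext b
      obtain ⟨b, rfl⟩ := grMk_surjective F j b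
      refine (grMk_eq_zero F _ _).2 ?_
      have ha' : (a : A) ∈ filLT F i := ha
      exact filLT_mul_mem F ha' b.2)

theorem grMul_mk {i j : ℕ} (a : F i) (b : F j) :
    grMul F i j (grMk F i a) (grMk F j b) =
      grMk F (i + j) ⟨a * b, SetLike.mul_mem_graded a.2 b.2⟩ := rfl

/-- The unit of the graded ring: the class of `1 ∈ F 0`. -/
def grOne : GrPiece F 0 := grMk F 0 ⟨1, SetLike.one_mem_graded F⟩

instance : GradedMonoid.GMul (GrPiece F) where
  mul {i j} a b := grMul F i j a b

instance : GradedMonoid.GOne (GrPiece F) where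
  one := grOne F

instance : GradedMonoid.GMonoid (GrPiece F) where
  one_mul := by
    rintro ⟨i, a⟩
    obtain ⟨a, rfl⟩ := grMk_surjective F i a
    exact gradedMonoid_ext F (zero_add i) _ _ (one_mul (a : A))
  mul_one := by
    rintro ⟨i, a⟩
    obtain ⟨a, rfl⟩ := grMk_surjective F i a
    exact gradedMonoid_ext F (add_zero i) _ _ (mul_one (a : A))
  mul_assoc := by
    rintro ⟨i, a⟩ ⟨j, b⟩ ⟨k, c⟩
    obtain ⟨a, rfl⟩ := grMk_surjective F i a
    obtain ⟨b, rfl⟩ := grMk_surjective F j b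
    obtain ⟨c, rfl⟩ := grMk_surjective F k c
    exact gradedMonoid_ext F (add_assoc i j k) _ _ (mul_assoc (a : A) b c)

instance : DirectSum.GCommRing (GrPiece F) where
  mul_comm := by
    rintro ⟨i, a⟩ ⟨j, b⟩
    obtain ⟨a, rfl⟩ := grMk_surjective F i a
    obtain ⟨b, rfl⟩ := grMk_surjective F j b
    exact gradedMonoid_ext F (add_comm i j) _ _ (mul_comm (a : A) b)
  mul_zero a := map_zero _
  zero_mul b := LinearMap.map_zero₂ _ b
  mul_add a b c := map_add _ b c
  add_mul a b c := LinearMap.map_add₂ _ a b c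
  natCast n := n • grOne F
  natCast_zero := zero_smul _ _
  natCast_succ n := succ_nsmul _ n
  intCast n := n • grOne F
  intCast_ofNat n := natCast_zsmul _ n
  intCast_negSucc_ofNat n := negSucc_zsmul _ n

instance : DirectSum.GAlgebra S (GrPiece F) where
  toFun := ((LinearMap.toSpanSingleton S (GrPiece F 0) (grOne F)) : S →+ GrPiece F 0)
  map_one := one_smul S (grOne F)
  map_mul r s := by
    refine gradedMonoid_ext F (zero_add 0).symm
      ((r * s) • ⟨1, SetLike.one_mem_graded F⟩) ⟨(r • 1) * (s • 1), _⟩ ?_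
    simp [mul_smul, smul_comm r s]
  commutes := by
    rintro r ⟨i, a⟩
    obtain ⟨a, rfl⟩ := grMk_surjective F i a
    refine gradedMonoid_ext F (add_comm 0 i) ⟨(r • 1) * a, _⟩ ⟨a * (r • 1), _⟩ ?_
    exact mul_comm _ _
  smul_def := by
    rintro r ⟨i, a⟩
    obtain ⟨a, rfl⟩ := grMk_surjective F i a
    refine gradedMonoid_ext F (zero_add i).symm (r • a) ⟨(r • 1) * a, _⟩ ?_
    simp

end Ring

/-- The class in degree `d` of the associated graded ring of an element `a` of `F d`. -/
def symb (d : ℕ) (a : A) (ha : a ∈ F d) : AssocGr F :=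
  DirectSum.of (GrPiece F) d (grMk F d ⟨a, ha⟩)

end AssociatedGraded

/-! ### Wreath products and types of their elements -/

/-- The wreath product `Γ_n = Γ^n ⋊ S_n`, with `(g, σ) (h, τ) = (g σ(h), σ τ)` and
`σ(h)_i = h_{σ⁻¹(i)}`. -/
abbrev Wreath (Γ : Type*) [Group Γ] (n : ℕ) : Type _ :=
  (Fin n → Γ) ⋊[mulAutArrow (G := Equiv.Perm (Fin n)) (A := Fin n) (M := Γ)] Equiv.Perm (Fin n)

/-- Partition-valued functions on the set of conjugacy classes of `Γ`; a partition is the multiset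
of its (positive) parts. -/
abbrev PartFun (Γ : Type*) [Group Γ] : Type _ := ConjClasses Γ → Multiset ℕ+

section Types

variable {Γ : Type*} [Group Γ]

/-- The degree `‖ρ‖`: the total size of the partitions `ρ(c)`. -/
def PartFun.degree (ρ : PartFun Γ) : ℕ := ∑ᶠ c, ((ρ c).map (fun k : ℕ+ => (k : ℕ))).sum

/-- The number `‖ρ‖ + ℓ(ρ(c⁰))`, where `c⁰` is the class of the identity. -/
def PartFun.supportSize (ρ : PartFun Γ) : ℕ := ρ.degree + (ρ 1).card

variable {n : ℕ}

/-- The product `g_{σ^{k-1}(i)} ⋯ g_{σ(i)} g_i`, for `x = (g, σ)`. -/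
def pathProd (x : Wreath Γ n) (i : Fin n) : ℕ → Γ
  | 0 => 1
  | k + 1 => x.left ((x.right ^ k) i) * pathProd x i k

/-- The length of the cycle of `σ` through `i`, for `x = (g, σ)`. -/
def cycleLen (x : Wreath Γ n) (i : Fin n) : ℕ+ :=
  ⟨Function.minimalPeriod x.right i, Function.minimalPeriod_pos_of_mem_periodicPts
    (Function.Injective.mem_periodicPts x.right.injective i)⟩

/-- The conjugacy class of the cycle-product `g_{i_k} ⋯ g_{i_1}` of the cycle
`(i_1 i_2 ⋯ i_k)` of `σ` that starts at `i_1 = i`, for `x = (g, σ)`. -/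
def cycleClass (x : Wreath Γ n) (i : Fin n) : ConjClasses Γ :=
  ConjClasses.mk (pathProd x i (cycleLen x i))

theorem pow_cycleLen (x : Wreath Γ n) (i : Fin n) : (x.right ^ (cycleLen x i : ℕ)) i = i := by
  rw [Equiv.Perm.coe_pow]
  exact Function.isPeriodicPt_minimalPeriod _ _

theorem cycleLen_apply (x : Wreath Γ n) (i : Fin n) : cycleLen x (x.right i) = cycleLen x i :=
  Subtype.ext (Function.minimalPeriod_apply
    (Function.Injective.mem_periodicPts x.right.injective i))

theorem pathProd_apply (x : Wreath Γ n) (i : Fin n) (k : ℕ) :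
    pathProd x (x.right i) k * x.left i = pathProd x i (k + 1) := by
  induction k with
  | zero => simp [pathProd]
  | succ k ih =>
    rw [pathProd, mul_assoc, ih, pathProd.eq_def x i (k + 1 + 1)]
    simp [pow_succ]

theorem cycleClass_apply (x : Wreath Γ n) (i : Fin n) :
    cycleClass x (x.right i) = cycleClass x i := by
  unfold cycleClass
  rw [cycleLen_apply, ConjClasses.mk_eq_mk_iff_isConj, isConj_comm, isConj_iff]
  refine ⟨x.left i, ?_⟩
  rw [mul_inv_eq_iff_eq_mul, pathProd_apply, pathProd, pow_cycleLen]

theorem sameCycle_induction {α : Type*} (x : Wreath Γ n) (f : Fin n → α)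
    (hf : ∀ i, f (x.right i) = f i) {i j : Fin n} (h : x.right.SameCycle i j) : f i = f j := by
  obtain ⟨k, rfl⟩ := h.exists_nat_pow_eq
  induction k with
  | zero => rfl
  | succ k ih =>
    rw [pow_succ', Equiv.Perm.mul_apply, hf]
    exact ih ⟨k, by simp⟩

/-- The set of cycles of `σ`, including the fixed points, for `x = (g, σ)`. -/
abbrev Cycles (x : Wreath Γ n) : Type := Quotient (Equiv.Perm.SameCycle.setoid x.right)

/-- The length of a cycle. -/
def Cycles.len (x : Wreath Γ n) : Cycles x → ℕ+ :=
  Quotient.lift (cycleLen x) fun _ _ h => sameCycle_induction x _ (cycleLen_apply x) h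

/-- The conjugacy class of the cycle-product of a cycle. -/
def Cycles.prodClass (x : Wreath Γ n) : Cycles x → ConjClasses Γ :=
  Quotient.lift (cycleClass x) fun _ _ h => sameCycle_induction x _ (cycleClass_apply x) h

instance (x : Wreath Γ n) : Fintype (Cycles x) := Fintype.ofFinite _

open scoped Classical in
/-- The type of `x`: the parts of `ρ(c)` are the lengths of the cycles whose cycle-product
lies in `c`. -/
def typeOf (x : Wreath Γ n) : PartFun Γ := fun c =>
  (Finset.univ.filter fun y : Cycles x => Cycles.prodClass x y = c).val.map (Cycles.len x)

open scoped Classical in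
/-- The modified type: in the partition attached to the identity class, every part is diminished
by `1` (and the parts equal to `1` disappear). -/
def modifiedType (x : Wreath Γ n) : PartFun Γ := fun c =>
  if c = 1 then ((typeOf x c).filter (fun k => 1 < k)).map (fun k => k - 1) else typeOf x c

theorem conj_left_apply (z x : Wreath Γ n) (i : Fin n) :
    (z * x * z⁻¹).left (z.right i) =
      z.left (z.right i) * x.left i * (z.left (z.right (x.right⁻¹ i)))⁻¹ := by
  have h : ∀ (σ : Equiv.Perm (Fin n)) (f : Fin n → Γ) (j : Fin n),
      (mulAutArrow (G := Equiv.Perm (Fin n)) σ f) j = f (σ⁻¹ j) := fun _ _ _ => rfl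
  simp [h, mul_assoc]
  rfl

theorem pathProd_conj (z x : Wreath Γ n) (i : Fin n) (k : ℕ) :
    pathProd (z * x * z⁻¹) (z.right i) k =
      z.left (z.right (x.right⁻¹ ((x.right ^ k) i))) * pathProd x i k *
        (z.left (z.right (x.right⁻¹ i)))⁻¹ := by
  induction k with
  | zero => simp [pathProd]
  | succ k ih =>
    have h : ((z * x * z⁻¹).right ^ k) (z.right i) = z.right ((x.right ^ k) i) := by
      have : (z * x * z⁻¹).right = z.right * x.right * z.right⁻¹ := by simp
      rw [this, conj_pow]
      simp
    rw [pathProd, h, conj_left_apply, ih, pathProd]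
    simp [pow_succ', mul_assoc]

theorem cycleLen_conj (z x : Wreath Γ n) (i : Fin n) :
    cycleLen (z * x * z⁻¹) (z.right i) = cycleLen x i := by
  refine Subtype.ext ?_
  change Function.minimalPeriod _ _ = Function.minimalPeriod _ _
  refine (Function.minimalPeriod_eq_minimalPeriod_iff).2 fun k => ?_
  unfold Function.IsPeriodicPt Function.IsFixedPt
  rw [← Equiv.Perm.coe_pow, ← Equiv.Perm.coe_pow]
  have : (z * x * z⁻¹).right = z.right * x.right * z.right⁻¹ := by simp
  rw [this, conj_pow]
  simp

theorem cycleClass_conj (z x : Wreath Γ n) (i : Fin n) :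
    cycleClass (z * x * z⁻¹) (z.right i) = cycleClass x i := by
  unfold cycleClass
  rw [cycleLen_conj, pathProd_conj, pow_cycleLen, ConjClasses.mk_eq_mk_iff_isConj, isConj_comm,
    isConj_iff]
  exact ⟨_, rfl⟩

theorem typeOf_conj (z x : Wreath Γ n) : typeOf (z * x * z⁻¹) = typeOf x := by
  classical
  let e : Cycles x ≃ Cycles (z * x * z⁻¹) := Quotient.congr z.right (by
    intro i j
    have : (z * x * z⁻¹).right = z.right * x.right * z.right⁻¹ := by simp
    change x.right.SameCycle i j ↔ (z * x * z⁻¹).right.SameCycle (z.right i) (z.right j)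
    rw [this, Equiv.Perm.sameCycle_conj]
    simp)
  have hlen : ∀ y, Cycles.len (z * x * z⁻¹) (e y) = Cycles.len x y := by
    rintro ⟨i⟩
    exact cycleLen_conj z x i
  have hclass : ∀ y, Cycles.prodClass (z * x * z⁻¹) (e y) = Cycles.prodClass x y := by
    rintro ⟨i⟩
    exact cycleClass_conj z x i
  funext c
  unfold typeOf
  rw [← Finset.map_univ_equiv e, Finset.filter_map, Finset.map_val, Multiset.map_map]
  simp [Function.comp_def, hlen, hclass]

theorem modifiedType_conj (z x : Wreath Γ n) : modifiedType (z * x * z⁻¹) = modifiedType x := by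
  unfold modifiedType
  rw [typeOf_conj]

end Types

/-! ### Class algebras -/

section ClassAlgebra

variable (Γ : Type*) [Group Γ] [Finite Γ]

instance (n : ℕ) : Finite (Wreath Γ n) := Finite.of_equiv _ SemidirectProduct.equivProd.symm

instance (n : ℕ) : Fintype (Wreath Γ n) := Fintype.ofFinite _

/-- The integral class algebra of `Γ_n`: the center of the group ring `ℤ[Γ_n]`. -/
abbrev ClassAlgebra (n : ℕ) : Type _ := Subalgebra.center ℤ (MonoidAlgebra ℤ (Wreath Γ n))

variable {Γ}

open scoped Classical in
/-- The sum in `ℤ[Γ_n]` of all elements of modified type `μ`. -/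
def classSum (n : ℕ) (μ : PartFun Γ) : MonoidAlgebra ℤ (Wreath Γ n) :=
  ∑ x : Wreath Γ n with modifiedType x = μ, MonoidAlgebra.of ℤ (Wreath Γ n) x

theorem classSum_mem_center (n : ℕ) (μ : PartFun Γ) :
    classSum n μ ∈ Subalgebra.center ℤ (MonoidAlgebra ℤ (Wreath Γ n)) := by
  classical
  have key : ∀ z : Wreath Γ n, MonoidAlgebra.of ℤ _ z * classSum n μ =
      classSum n μ * MonoidAlgebra.of ℤ _ z := by
    intro z
    unfold classSum
    rw [Finset.mul_sum, Finset.sum_mul]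
    refine Finset.sum_equiv (MulAut.conj z).toEquiv (fun x => ?_) fun x _ => ?_
    · simp [modifiedType_conj]
    · rw [← map_mul, ← map_mul]
      simp
  rw [Subalgebra.mem_center_iff]
  intro b
  induction b using MonoidAlgebra.induction_on with
  | of z => exact key z
  | add a b ha hb => rw [add_mul, mul_add, ha, hb]
  | smul r a ha => rw [smul_mul_assoc, mul_smul_comm, ha]

/-- The element `K_μ(n)` of the class algebra. -/
def K (n : ℕ) (μ : PartFun Γ) : ClassAlgebra Γ n := ⟨classSum n μ, classSum_mem_center n μ⟩

end ClassAlgebra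

/-! ### Filtrations by degree -/

section Filtration

variable {Γ : Type*} [Group Γ] {S A : Type*} [CommRing S] [CommRing A] [Algebra S A]

/-- The filtration obtained by assigning degree `‖μ‖` to `b μ`: its `d`-th term is spanned by
the `b μ` with `‖μ‖ ≤ d`. -/
def degFil (S : Type*) [CommRing S] [Algebra S A] (b : PartFun Γ → A) (d : ℕ) : Submodule S A :=
  Submodule.span S (b '' {μ | μ.degree ≤ d})

theorem mem_degFil (b : PartFun Γ → A) (μ : PartFun Γ) : b μ ∈ degFil S b μ.degree :=
  Submodule.subset_span ⟨μ, le_refl μ.degree, rfl⟩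

/-- The class of `b μ` in degree `‖μ‖` of the graded ring associated to the filtration
by degree. -/
def grClass (S : Type*) [CommRing S] [Algebra S A] (b : PartFun Γ → A) (μ : PartFun Γ) :
    AssocGr (degFil S b) :=
  symb (degFil S b) μ.degree (b μ) (mem_degFil b μ)

/-- Multiplication table: `b λ * b μ = ∑ ν, c λ μ ν • b ν`. -/
def HasMulTable {T : Type*} [Zero T] [SMul T A] (b : PartFun Γ → A)
    (c : PartFun Γ → PartFun Γ → PartFun Γ →₀ T) : Prop :=
  ∀ l m, b l * b m = (c l m).sum fun ν r => r • b ν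

end Filtration

/-! ### Integer-valued polynomials -/

/-- The ring `R` of polynomials in `ℚ[t]` that take integer values at all integers. -/
def intValued : Subring ℚ[X] where
  carrier := {p | ∀ n : ℤ, ∃ m : ℤ, p.eval (n : ℚ) = m}
  mul_mem' {p q} hp hq n := by
    obtain ⟨a, ha⟩ := hp n
    obtain ⟨b, hb⟩ := hq n
    exact ⟨a * b, by simp [ha, hb]⟩
  add_mem' {p q} hp hq n := by
    obtain ⟨a, ha⟩ := hp n
    obtain ⟨b, hb⟩ := hq n
    exact ⟨a + b, by simp [ha, hb]⟩
  neg_mem' {p} hp n := by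
    obtain ⟨a, ha⟩ := hp n
    exact ⟨-a, by simp [ha]⟩
  one_mem' n := ⟨1, by simp⟩
  zero_mem' n := ⟨0, by simp⟩

/-- The integer value of `p ∈ R` at the integer `n`. -/
def intEval (p : intValued) (n : ℤ) : ℤ := Classical.choose (p.2 n)

theorem intEval_spec (p : intValued) (n : ℤ) :
    (p : ℚ[X]).eval (n : ℚ) = (intEval p n : ℚ) := Classical.choose_spec (p.2 n)

end FarahatHigman

end

open FarahatHigman

/-! `Γ_n` acts on the vectors in `(Γ ∪ {0})^n` like a group of monomial matrices. The vectors fixed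
by `x` number `(|Γ| + 1)^(n - ‖μ‖)`, where `μ` is the modified type of `x`, and they are cut out by
`‖μ‖` monomial equations. One such equation divides the number of solutions of a system by at most
`|Γ| + 1`, just as a linear equation lowers the dimension by at most one; as `x y` fixes every
vector fixed by `x` and `y`, it follows that the degree is subadditive. If
`‖x y‖ = ‖x‖ + ‖y‖`, then `x y` fixes only the vectors fixed by both `x` and `y`, and therefore
`x` and `y` move no point that `x y` does not move.

An element is determined up to conjugacy by its modified type. Hence the number of factorizations
`z = x y` with factors of types `λ` and `μ` such that the union of the supports of `x` and `y`
exceeds the support of `z` by a given set of `k` points depends only on `λ`, `μ`, `k` and the type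
`ν` of `z`. There are `choose (n - |supp z|) k` such sets, and so the coefficient of `K_ν(n)` in
`K_λ(n) K_μ(n)` is the value at `n` of an integer-valued polynomial, which in top degree is reduced
to its constant term `k = 0`.

The two rings are realised as the span of the sequences `(K_μ(n))_n` in the product of all class
algebras, and as the `ℤ`-span of the classes of the `K_μ` in its associated graded ring. -/

noncomputable section

namespace FarahatHigman

/-! ### Bases of the associated graded ring -/

section Filtration

variable {S A : Type*} [CommRing S] [CommRing A] [Algebra S A]

/-- The symbol map in degree `d`, as a linear map. -/
def symbₗ (F : ℕ → Submodule S A) (d : ℕ) : F d →ₗ[S] AssocGr F :=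
  DirectSum.lof S ℕ (GrPiece F) d ∘ₗ grMk F d

theorem symb_eq_symbₗ (F : ℕ → Submodule S A) (d : ℕ) {a : A} (ha : a ∈ F d) :
    symb F d a ha = symbₗ F d ⟨a, ha⟩ := rfl

theorem symb_eq_zero_iff {F : ℕ → Submodule S A} {d : ℕ} {a : A} (ha : a ∈ F d) :
    symb F d a ha = 0 ↔ a ∈ filLT F d := by
  rw [symb, map_eq_zero_iff _ (DirectSum.of_injective d)]
  exact grMk_eq_zero F d ⟨a, ha⟩

variable {Γ : Type*} [Group Γ]

theorem degree_zero : PartFun.degree (0 : PartFun Γ) = 0 := by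
  simp [PartFun.degree]

theorem supportSize_zero : PartFun.supportSize (0 : PartFun Γ) = 0 := by
  simp [PartFun.supportSize, degree_zero]

theorem degFil_mono (b : PartFun Γ → A) : Monotone (degFil S b) := fun _ _ hij =>
  Submodule.span_mono (Set.image_mono fun _ hμ => le_trans (Set.mem_ofPred.1 hμ) hij)

theorem mem_degFil_of_le (b : PartFun Γ → A) {μ : PartFun Γ} {d : ℕ} (h : μ.degree ≤ d) :
    b μ ∈ degFil S b d :=
  degFil_mono b h (mem_degFil b μ)

theorem filLT_degFil (b : PartFun Γ → A) (d : ℕ) :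
    filLT (degFil S b) d = Submodule.span S (b '' {μ | μ.degree < d}) := by
  refine le_antisymm ?_ (Submodule.span_le.2 ?_)
  · exact iSup₂_le fun _ hi => Submodule.span_mono (Set.image_mono fun _ hμ => lt_of_le_of_lt hμ hi)
  · rintro _ ⟨μ, hμ, rfl⟩
    exact le_iSup₂_of_le (f := fun i (_ : i < d) => degFil S b i) μ.degree hμ le_rfl
      (mem_degFil b μ)

theorem isRingFiltration_degFil {b : PartFun Γ → A} {c : PartFun Γ → PartFun Γ → PartFun Γ →₀ S}
    (hb : HasMulTable b c) (hone : b 0 = 1)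
    (hc : ∀ l m ν, c l m ν ≠ 0 → ν.degree ≤ l.degree + m.degree) :
    IsRingFiltration (degFil S b) (filLT (degFil S b)) where
  mono := degFil_mono b
  is_le {i j} hij := le_iSup₂_of_le (f := fun i (_ : i < j) => degFil S b i) i hij le_rfl
  is_sup B j h := iSup₂_le h
  one_mem := hone ▸ mem_degFil_of_le b degree_zero.le
  mul_mem {i j} x y hx hy := by
    suffices h : degFil S b i * degFil S b j ≤ degFil S b (i + j) from
      h (Submodule.mul_mem_mul hx hy)
    rw [degFil, degFil, Submodule.span_mul_span, Submodule.span_le]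
    rintro _ ⟨_, ⟨l, hl, rfl⟩, _, ⟨m, hm, rfl⟩, rfl⟩
    change b l * b m ∈ degFil S b (i + j)
    rw [hb l m]
    refine Submodule.sum_mem _ fun ν hν => Submodule.smul_mem _ _ (mem_degFil_of_le b ?_)
    exact (hc l m ν (Finsupp.mem_support_iff.1 hν)).trans (add_le_add hl hm)

theorem grClass_eq_zero {b : PartFun Γ → A} {μ : PartFun Γ} (h : b μ = 0) :
    grClass S b μ = 0 :=
  (symb_eq_zero_iff _).2 (h ▸ Submodule.zero_mem _)

theorem grClass_zero_eq_one {b : PartFun Γ → A}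
    [IsRingFiltration (degFil S b) (filLT (degFil S b))] (hone : b 0 = 1) :
    grClass S b 0 = 1 := by
  suffices h : ∀ (d : ℕ) (hd : b 0 ∈ degFil S b d), d = 0 →
      symb (degFil S b) d (b 0) hd = DirectSum.of (GrPiece (degFil S b)) 0 (grOne _) from
    h _ _ degree_zero
  rintro d hd rfl
  rw [symb, grOne]
  congr 2
  exact Subtype.ext hone

theorem symb_sum_smul {ι : Type*} (b : PartFun Γ → A) (v : ι → PartFun Γ) (g : ι → S) {d : ℕ}
    {s : Finset ι} (hs : ∀ i ∈ s, (v i).degree ≤ d) (h : ∑ i ∈ s, g i • b (v i) ∈ degFil S b d) :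
    symb (degFil S b) d (∑ i ∈ s, g i • b (v i)) h =
      ∑ i ∈ s with (v i).degree = d, g i • grClass S b (v i) := by
  classical
  induction s using Finset.induction_on with
  | empty => exact (symb_eq_zero_iff h).2 (Submodule.zero_mem _)
  | insert i t hi ih =>
    rw [Finset.forall_mem_insert] at hs
    have hsum : ∑ i ∈ t, g i • b (v i) ∈ degFil S b d :=
      Submodule.sum_mem _ fun j hj => Submodule.smul_mem _ _ (mem_degFil_of_le b (hs.2 j hj))
    have hadd : symb (degFil S b) d (∑ j ∈ insert i t, g j • b (v j)) h =
        g i • symb (degFil S b) d (b (v i)) (mem_degFil_of_le b hs.1) +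
          symb (degFil S b) d (∑ j ∈ t, g j • b (v j)) hsum := by
      simp only [symb_eq_symbₗ, ← map_smul, ← map_add, Finset.sum_insert hi]
      rfl
    rw [hadd, ih hs.2 hsum, Finset.filter_insert]
    split_ifs with hd
    · rw [Finset.sum_insert fun h => hi (Finset.mem_of_mem_filter _ h)]
      subst hd
      rfl
    · have hlt : b (v i) ∈ filLT (degFil S b) d := by
        rw [filLT_degFil]
        exact Submodule.subset_span ⟨v i, lt_of_le_of_ne hs.1 hd, rfl⟩
      rw [(symb_eq_zero_iff _).2 hlt, smul_zero, zero_add]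

/-- The table `c` of structure constants respects degrees, and `a` is its part of top degree,
which consists of natural numbers. -/
structure IsTopPart (c : PartFun Γ → PartFun Γ → PartFun Γ →₀ S)
    (a : PartFun Γ → PartFun Γ → PartFun Γ →₀ ℕ) : Prop where
  degree_le : ∀ l m ν, c l m ν ≠ 0 → ν.degree ≤ l.degree + m.degree
  degree_eq : ∀ l m ν, a l m ν ≠ 0 → ν.degree = l.degree + m.degree
  eq_natCast : ∀ l m ν, ν.degree = l.degree + m.degree → c l m ν = (a l m ν : S)

theorem hasMulTable_grClass {b : PartFun Γ → A} {c : PartFun Γ → PartFun Γ → PartFun Γ →₀ S}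
    {a : PartFun Γ → PartFun Γ → PartFun Γ →₀ ℕ}
    [IsRingFiltration (degFil S b) (filLT (degFil S b))] (hb : HasMulTable b c)
    (hca : IsTopPart c a) : HasMulTable (grClass S b) a := by
  intro l m
  have hmem : (c l m).sum (fun ν r => r • b ν) ∈ degFil S b (l.degree + m.degree) :=
    hb l m ▸ SetLike.mul_mem_graded (mem_degFil b l) (mem_degFil b m)
  calc grClass S b l * grClass S b m
      = symb (degFil S b) (l.degree + m.degree) (b l * b m) (hb l m ▸ hmem) :=
        DirectSum.of_mul_of _ _
    _ = symb (degFil S b) (l.degree + m.degree) ((c l m).sum fun ν r => r • b ν) hmem := by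
        simp only [hb l m]
    _ = ∑ ν ∈ (c l m).support with ν.degree = l.degree + m.degree, c l m ν • grClass S b ν :=
        symb_sum_smul b id (c l m)
          (fun ν hν => hca.degree_le l m ν (Finsupp.mem_support_iff.1 hν)) _
    _ = (a l m).sum fun ν k => k • grClass S b ν := by
        refine Finset.sum_congr_of_eq_on_inter ?_ ?_ ?_
        · intro ν hν hν'
          rw [hca.eq_natCast l m ν (Finset.mem_filter.1 hν).2, Finsupp.notMem_support_iff.1 hν',
            Nat.cast_zero, zero_smul]
        · intro ν hν hν'
          have hdeg := hca.degree_eq l m ν (Finsupp.mem_support_iff.1 hν)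
          have hc : c l m ν = 0 := by simpa [hdeg] using hν'
          change a l m ν • grClass S b ν = 0
          rw [← Nat.cast_smul_eq_nsmul S, ← hca.eq_natCast l m ν hdeg, hc, zero_smul]
        · intro ν hν _
          rw [hca.eq_natCast l m ν (Finset.mem_filter.1 hν).2, Nat.cast_smul_eq_nsmul]

theorem lof_component_grClass (b : PartFun Γ → A) (d : ℕ) (μ : PartFun Γ) :
    DirectSum.lof S ℕ (GrPiece (degFil S b)) d (DirectSum.component S ℕ _ d (grClass S b μ)) =
      if μ.degree = d then grClass S b μ else 0 := by
  split_ifs with hd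
  · subst hd
    rw [grClass, symb, ← DirectSum.lof_eq_of S, DirectSum.component.lof_self]
  · rw [grClass, symb, ← DirectSum.lof_eq_of S, DirectSum.component.of, dif_neg hd, map_zero]

theorem sum_smul_mem_filLT {ι : Type*} {b : PartFun Γ → A} {v : ι → PartFun Γ} {g : ι → S}
    {s : Finset ι} (h : ∑ i ∈ s, g i • grClass S b (v i) = 0) (d : ℕ) :
    ∑ i ∈ s with (v i).degree = d, g i • b (v i) ∈ filLT (degFil S b) d := by
  have hdeg : ∀ i ∈ {i ∈ s | (v i).degree = d}, (v i).degree ≤ d := fun i hi =>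
    (Finset.mem_filter.1 hi).2.le
  have hcomponent := congrArg
    (DirectSum.lof S ℕ (GrPiece (degFil S b)) d ∘ₗ DirectSum.component S ℕ _ d) h
  simp only [map_sum, map_smul, LinearMap.comp_apply, lof_component_grClass, map_zero, smul_ite,
    smul_zero, ← Finset.sum_filter] at hcomponent
  rw [← symb_eq_zero_iff (Submodule.sum_mem _ fun i hi =>
    Submodule.smul_mem _ _ (mem_degFil_of_le b (hdeg i hi))), symb_sum_smul b v g hdeg,
    Finset.filter_filter]
  simpa only [and_self] using hcomponent

theorem span_image_eq_span_image_subtype {R M ι : Type*} [Semiring R] [AddCommMonoid M] [Module R M]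
    {v : ι → M} {p : ι → Prop} (hp : ∀ i, ¬ p i → v i = 0) (T : Set ι) :
    Submodule.span R (v '' T) =
      Submodule.span R ((fun i : {i // p i} => v i) '' {i | (i : ι) ∈ T}) := by
  refine le_antisymm (Submodule.span_le.2 ?_) (Submodule.span_mono ?_)
  · rintro _ ⟨i, hi, rfl⟩
    by_cases h : p i
    · exact Submodule.subset_span ⟨⟨i, h⟩, hi, rfl⟩
    · rw [hp i h]
      exact Submodule.zero_mem _
  · rintro _ ⟨i, hi, rfl⟩
    exact ⟨i, hi, rfl⟩

theorem linearIndependent_grClass {b : PartFun Γ → A} {p : PartFun Γ → Prop}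
    (hp : ∀ μ, ¬ p μ → b μ = 0) (hli : LinearIndependent S fun μ : {μ // p μ} => b μ) :
    LinearIndependent S fun μ : {μ // p μ} => grClass S b (μ : PartFun Γ) := by
  rw [linearIndependent_iff']
  intro s g hg i hi
  set d := (i : PartFun Γ).degree
  have hlt := sum_smul_mem_filLT hg d
  rw [filLT_degFil, span_image_eq_span_image_subtype hp] at hlt
  have heq : ∑ μ ∈ s with μ.1.degree = d, g μ • b μ.1 ∈
      Submodule.span S ((fun μ : {μ // p μ} => b μ) '' {μ | (μ : PartFun Γ).degree = d}) :=
    Submodule.sum_mem _ fun μ hμ => Submodule.smul_mem _ _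
      (Submodule.subset_span ⟨μ, (Finset.mem_filter.1 hμ).2, rfl⟩)
  have hdisjoint : Disjoint {μ : {μ // p μ} | (μ : PartFun Γ).degree = d}
      {μ | (μ : PartFun Γ).degree < d} :=
    Set.disjoint_left.2 fun μ h h' => (ne_of_lt (Set.mem_ofPred.1 h')) h
  have hzero := Submodule.disjoint_def.1 (hli.disjoint_span_image hdisjoint) _ heq hlt
  exact linearIndependent_iff'.1 hli _ g hzero i (Finset.mem_filter.2 ⟨hi, rfl⟩)

theorem range_lof_degFil (b : PartFun Γ → A) (d : ℕ) :
    LinearMap.range (DirectSum.lof S ℕ (GrPiece (degFil S b)) d) =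
      Submodule.span S (grClass S b '' {μ | μ.degree = d}) := by
  refine le_antisymm ?_ (Submodule.span_le.2 ?_)
  · rintro _ ⟨x, rfl⟩
    obtain ⟨⟨a, ha⟩, rfl⟩ := grMk_surjective _ d x
    obtain ⟨r, hr, rfl⟩ := Finsupp.mem_span_image_iff_linearCombination S |>.1 ha
    change symb (degFil S b) d (Finsupp.linearCombination S b r) ha ∈ _
    rw [show symb _ d _ ha = _ from symb_sum_smul b id r (fun ν hν => hr hν) ha]
    exact Submodule.sum_mem _ fun ν hν => Submodule.smul_mem _ _
      (Submodule.subset_span ⟨ν, (Finset.mem_filter.1 hν).2, rfl⟩)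
  · rintro _ ⟨μ, rfl, rfl⟩
    exact ⟨_, rfl⟩

theorem span_grClass (b : PartFun Γ → A) :
    Submodule.span S (grClass S b '' Set.univ) = ⊤ := by
  refine eq_top_iff.2 fun x _ => ?_
  induction x using DirectSum.induction_on with
  | zero => exact Submodule.zero_mem _
  | add x y hx hy => exact Submodule.add_mem _ (hx trivial) (hy trivial)
  | of d x =>
    exact Submodule.span_mono (Set.image_mono (Set.subset_univ _))
      ((range_lof_degFil (S := S) b d).le ⟨x, rfl⟩)

theorem exists_basis_grClass {b : PartFun Γ → A} {p : PartFun Γ → Prop}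
    (hp : ∀ μ, ¬ p μ → b μ = 0) (hli : LinearIndependent S fun μ : {μ // p μ} => b μ) :
    ∃ B : Module.Basis {μ // p μ} S (AssocGr (degFil S b)), ∀ μ, B μ = grClass S b μ := by
  refine ⟨Module.Basis.mk (linearIndependent_grClass hp hli) ?_, fun μ => Module.Basis.mk_apply ..⟩
  rw [← span_grClass b,
    span_image_eq_span_image_subtype (v := grClass S b) fun μ h => grClass_eq_zero (hp μ h)]
  exact Submodule.span_mono (Set.image_subset_range _ _)

end Filtration

/-! ### Points and cycles -/

section Cycles

variable {Γ : Type*} [Group Γ] {n : ℕ}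

open scoped Classical in
/-- The support of `x = (g, σ)`: the points `i` with `σ i ≠ i` or `g i ≠ 1`. -/
def supp (x : Wreath Γ n) : Finset (Fin n) := {i | ¬ (x.right i = i ∧ x.left i = 1)}

theorem mem_supp {x : Wreath Γ n} {i : Fin n} :
    i ∈ supp x ↔ ¬ (x.right i = i ∧ x.left i = 1) := by
  simp [supp]

theorem notMem_supp {x : Wreath Γ n} {i : Fin n} :
    i ∉ supp x ↔ x.right i = i ∧ x.left i = 1 := by
  rw [mem_supp, not_not]

theorem cycleLen_eq_one {x : Wreath Γ n} {i : Fin n} : cycleLen x i = 1 ↔ x.right i = i := by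
  rw [← PNat.coe_inj]
  exact Function.minimalPeriod_eq_one_iff_isFixedPt

theorem notMem_supp_iff_cycle {x : Wreath Γ n} {i : Fin n} :
    i ∉ supp x ↔ cycleClass x i = 1 ∧ cycleLen x i = 1 := by
  rw [notMem_supp, cycleLen_eq_one, and_comm (a := cycleClass x i = 1)]
  refine and_congr_right fun h => ?_
  rw [cycleClass, cycleLen_eq_one.2 h, ConjClasses.one_eq_mk_one, ConjClasses.mk_eq_mk_iff_isConj,
    isConj_comm, isConj_one_right]
  simp [pathProd]

theorem right_pow_eq_iff (x : Wreath Γ n) (i : Fin n) (k l : ℕ) :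
    (x.right ^ k) i = (x.right ^ l) i ↔ k ≡ l [MOD (cycleLen x i : ℕ)] := by
  have hpos : 0 < Function.minimalPeriod x.right i := (cycleLen x i).pos
  rw [Equiv.Perm.coe_pow, Equiv.Perm.coe_pow,
    ← Function.iterate_mod_minimalPeriod_eq (f := x.right) (n := k),
    ← Function.iterate_mod_minimalPeriod_eq (f := x.right) (n := l)]
  exact (Function.iterate_injOn_Iio_minimalPeriod (f := x.right) (x := i)).eq_iff
    (Nat.mod_lt _ hpos) (Nat.mod_lt _ hpos)

/-- The cycle of `σ` through a point, for `x = (g, σ)`. -/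
def Cycles.of (x : Wreath Γ n) (i : Fin n) : Cycles x :=
  Quotient.mk (Equiv.Perm.SameCycle.setoid x.right) i

theorem Cycles.of_eq_of {x : Wreath Γ n} {i j : Fin n} :
    Cycles.of x i = Cycles.of x j ↔ x.right.SameCycle i j :=
  Quotient.eq (r := Equiv.Perm.SameCycle.setoid x.right)

theorem Cycles.of_out {x : Wreath Γ n} (y : Cycles x) : Cycles.of x y.out = y :=
  Quotient.out_eq y

theorem Cycles.of_pow_apply (x : Wreath Γ n) (l : ℕ) (i : Fin n) :
    Cycles.of x ((x.right ^ l) i) = Cycles.of x i :=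
  Cycles.of_eq_of.2 (Equiv.Perm.SameCycle.symm ⟨l, by simp⟩)

@[simp] theorem Cycles.len_of (x : Wreath Γ n) (i : Fin n) :
    Cycles.len x (Cycles.of x i) = cycleLen x i := rfl

@[simp] theorem Cycles.prodClass_of (x : Wreath Γ n) (i : Fin n) :
    Cycles.prodClass x (Cycles.of x i) = cycleClass x i := rfl

theorem Cycles.len_eq_cycleLen_out {x : Wreath Γ n} (y : Cycles x) :
    Cycles.len x y = cycleLen x y.out := by
  rw [← Cycles.len_of, Cycles.of_out]

theorem Cycles.prodClass_eq_cycleClass_out {x : Wreath Γ n} (y : Cycles x) :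
    Cycles.prodClass x y = cycleClass x y.out := by
  rw [← Cycles.prodClass_of, Cycles.of_out]

theorem exists_pow_out_eq (x : Wreath Γ n) (i : Fin n) :
    ∃ l, (x.right ^ l) (Cycles.of x i).out = i :=
  (Cycles.of_eq_of.1 (Cycles.of_out (Cycles.of x i))).exists_nat_pow_eq

theorem exists_eq_pow_out (x : Wreath Γ n) (i : Fin n) :
    ∃ (y : Cycles x) (l : ℕ), i = (x.right ^ l) y.out :=
  let ⟨l, hl⟩ := exists_pow_out_eq x i
  ⟨_, l, hl.symm⟩

theorem exists_lift_of_periodic {α : Type*} {x : Wreath Γ n} (U : Cycles x → ℕ → α)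
    (hU : ∀ y, Function.Periodic (U y) (Cycles.len x y)) :
    ∃ u : Fin n → α, ∀ y l, u ((x.right ^ l) y.out) = U y l := by
  choose exponent hexponent using exists_pow_out_eq x
  refine ⟨fun i => U (Cycles.of x i) (exponent i), fun y l => ?_⟩
  have hpow := hexponent ((x.right ^ l) y.out)
  simp only [Cycles.of_pow_apply, Cycles.of_out, right_pow_eq_iff] at hpow ⊢
  rw [← Cycles.len_eq_cycleLen_out] at hpow
  rw [← (hU y).map_mod_nat, hpow, (hU y).map_mod_nat]

open scoped Classical in
theorem card_fiber_of (x : Wreath Γ n) (y : Cycles x) :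
    Finset.card {i | Cycles.of x i = y} = Cycles.len x y := by
  rw [← Finset.card_range (Cycles.len x y : ℕ), Cycles.len_eq_cycleLen_out]
  symm
  refine Finset.card_nbij (fun k => (x.right ^ k) y.out) (fun k _ => ?_) ?_ ?_
  · simp [Cycles.of_pow_apply, Cycles.of_out]
  · intro k hk l hl h
    exact Nat.ModEq.eq_of_lt_of_lt ((right_pow_eq_iff x _ k l).1 h) (Finset.mem_range.1 hk)
      (Finset.mem_range.1 hl)
  · intro i hi
    obtain ⟨k, hk⟩ := exists_pow_out_eq x i
    rw [(Finset.mem_filter.1 hi).2] at hk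
    exact ⟨k % cycleLen x y.out, Finset.mem_coe.2 (Finset.mem_range.2 (Nat.mod_lt _ (PNat.pos _))),
      ((right_pow_eq_iff x _ _ k).2 (Nat.mod_modEq _ _)).trans hk⟩

theorem sum_comp_of (x : Wreath Γ n) (f : Cycles x → ℕ) :
    ∑ i, f (Cycles.of x i) = ∑ y, (Cycles.len x y : ℕ) * f y := by
  classical
  simp_rw [← Finset.sum_fiberwise (Finset.univ : Finset (Fin n)) (Cycles.of x),
    ← card_fiber_of, ← smul_eq_mul]
  refine Finset.sum_congr rfl fun y _ => ?_
  exact Finset.sum_eq_card_nsmul fun i hi => congrArg f (Finset.mem_filter.1 hi).2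

open scoped Classical in
/-- The points on the cycles of length `k` with cycle-product in `c`. -/
def points (x : Wreath Γ n) (c : ConjClasses Γ) (k : ℕ+) : Finset (Fin n) :=
  {i | cycleClass x i = c ∧ cycleLen x i = k}

theorem mem_points {x : Wreath Γ n} {c : ConjClasses Γ} {k : ℕ+} {i : Fin n} :
    i ∈ points x c k ↔ cycleClass x i = c ∧ cycleLen x i = k := by
  simp [points]

theorem points_one_one (x : Wreath Γ n) : points x 1 1 = (supp x)ᶜ := by
  ext i
  rw [Finset.mem_compl, notMem_supp_iff_cycle, mem_points]

open scoped Classical in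
theorem count_typeOf (x : Wreath Γ n) (c : ConjClasses Γ) (k : ℕ+) :
    (typeOf x c).count k =
      Finset.card {y : Cycles x | Cycles.prodClass x y = c ∧ Cycles.len x y = k} := by
  rw [typeOf, Multiset.count_map, Finset.card_def, ← Finset.filter_filter, Finset.filter_val]
  simp only [eq_comm (a := k)]
  rfl

theorem card_points (x : Wreath Γ n) (c : ConjClasses Γ) (k : ℕ+) :
    (points x c k).card = k * (typeOf x c).count k := by
  classical
  calc (points x c k).card
      = ∑ i, if Cycles.prodClass x (Cycles.of x i) = c ∧ Cycles.len x (Cycles.of x i) = k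
          then 1 else 0 := by
        rw [points, Finset.card_filter]
        rfl
    _ = ∑ y, (Cycles.len x y : ℕ) *
          if Cycles.prodClass x y = c ∧ Cycles.len x y = k then 1 else 0 :=
        sum_comp_of x fun y => if Cycles.prodClass x y = c ∧ Cycles.len x y = k then 1 else 0
    _ = k * (typeOf x c).count k := by
        simp_rw [mul_ite, mul_one, mul_zero]
        rw [← Finset.sum_filter, Finset.sum_eq_card_nsmul (b := (k : ℕ)), ← count_typeOf,
          smul_eq_mul, mul_comm]
        intro y hy
        rw [(Finset.mem_filter.1 hy).2.2]

open scoped Classical in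
/-- The length of the cycles that are recorded by a part `k` of `μ(c)`, where `μ` is the
modified type. -/
def unshift (c : ConjClasses Γ) (k : ℕ+) : ℕ+ := if c = 1 then k + 1 else k

theorem unshift_ne (c : ConjClasses Γ) (k : ℕ+) : ¬ (c = 1 ∧ unshift c k = 1) := by
  rintro ⟨hc, hk⟩
  rw [unshift, if_pos hc] at hk
  exact (PNat.lt_add_left 1 k).ne' hk

theorem exists_unshift_eq {c : ConjClasses Γ} {k : ℕ+} (h : ¬ (c = 1 ∧ k = 1)) :
    ∃ k', unshift c k' = k := by
  by_cases hc : c = 1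
  · have hk : 1 < k := lt_of_le_of_ne one_le fun hk => h ⟨hc, hk.symm⟩
    exact ⟨k - 1, by rw [unshift, if_pos hc, PNat.sub_add_of_lt hk]⟩
  · exact ⟨k, by rw [unshift, if_neg hc]⟩

theorem count_modifiedType (x : Wreath Γ n) (c : ConjClasses Γ) (k : ℕ+) :
    (modifiedType x c).count k = (typeOf x c).count (unshift c k) := by
  by_cases h : c = 1
  · rw [modifiedType, if_pos h, unshift, if_pos h, Multiset.count_map, Multiset.count,
      Multiset.countP_eq_card_filter, Multiset.filter_filter]
    congr 1
    refine Multiset.filter_congr fun l _ => ?_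
    constructor
    · rintro ⟨rfl, hl⟩
      rw [PNat.sub_add_of_lt hl]
    · rintro rfl
      exact ⟨PNat.add_sub.symm, PNat.lt_add_left 1 k⟩
  · rw [modifiedType, if_neg h, unshift, if_neg h]

theorem card_points_unshift (x : Wreath Γ n) (c : ConjClasses Γ) (k : ℕ+) :
    (points x c (unshift c k)).card = unshift c k * (modifiedType x c).count k := by
  rw [card_points, count_modifiedType]

theorem modifiedType_eq_of_card_points {m : ℕ} {x : Wreath Γ n} {y : Wreath Γ m}
    (h : ∀ c k, ¬ (c = 1 ∧ k = 1) → (points x c k).card = (points y c k).card) :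
    modifiedType x = modifiedType y := by
  classical
  refine funext fun c => Multiset.ext.2 fun k => ?_
  refine Nat.eq_of_mul_eq_mul_left (unshift c k).pos ?_
  rw [← card_points_unshift, ← card_points_unshift, h c _ (unshift_ne c k)]

theorem modifiedType_eq_add {m l : ℕ} {x : Wreath Γ n} {y : Wreath Γ m} {z : Wreath Γ l}
    (h : ∀ c k, ¬ (c = 1 ∧ k = 1) →
      (points z c k).card = (points x c k).card + (points y c k).card) :
    modifiedType z = modifiedType x + modifiedType y := by
  classical
  refine funext fun c => Multiset.ext.2 fun k => ?_
  refine Nat.eq_of_mul_eq_mul_left (unshift c k).pos ?_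
  rw [Pi.add_apply, Multiset.count_add, mul_add, ← card_points_unshift, ← card_points_unshift,
    ← card_points_unshift, h c _ (unshift_ne c k)]

open scoped Classical in
/-- The cycles with trivial cycle-product. -/
def balanced (x : Wreath Γ n) : Finset (Cycles x) := {y | Cycles.prodClass x y = 1}

theorem mem_balanced {x : Wreath Γ n} {y : Cycles x} :
    y ∈ balanced x ↔ Cycles.prodClass x y = 1 := by
  simp [balanced]

theorem sum_map_sub_one_filter (s : Multiset ℕ+) :
    (((s.filter (1 < ·)).map (· - 1)).map fun k : ℕ+ => (k : ℕ)).sum =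
      (s.map fun k : ℕ+ => (k : ℕ) - 1).sum := by
  induction s using Multiset.induction_on with
  | empty => rfl
  | cons a s ih =>
    by_cases ha : 1 < a
    · simp [ha, PNat.sub_coe, ← ih]
    · have ha' : a = 1 := le_antisymm (not_lt.1 ha) one_le
      simp [ha', ← ih]

open scoped Classical in
theorem sum_modifiedType (x : Wreath Γ n) (c : ConjClasses Γ) :
    ((modifiedType x c).map fun k : ℕ+ => (k : ℕ)).sum =
      ∑ y with Cycles.prodClass x y = c,
        ((Cycles.len x y : ℕ) - if Cycles.prodClass x y = 1 then 1 else 0) := by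
  rw [Finset.sum_congr rfl (g := fun y => (Cycles.len x y : ℕ) - if c = 1 then 1 else 0)
    fun y hy => by rw [(Finset.mem_filter.1 hy).2], modifiedType]
  split_ifs
  · rw [sum_map_sub_one_filter, typeOf, Multiset.map_map]
    rfl
  · rw [typeOf, Multiset.map_map]
    rfl

theorem card_modifiedType_one_add_count (x : Wreath Γ n) :
    (modifiedType x 1).card + (typeOf x 1).count 1 = (balanced x).card := by
  have hcard : (typeOf x 1).card = (balanced x).card := by
    rw [typeOf, Multiset.card_map, balanced, Finset.card_def]
  have hfilter : (typeOf x 1).filter (fun k => 1 < k) = (typeOf x 1).filter (fun k => ¬ 1 = k) :=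
    Multiset.filter_congr fun k _ => by rw [lt_iff_le_and_ne, and_iff_right one_le]
  rw [modifiedType, if_pos rfl, Multiset.card_map, Multiset.count, Multiset.countP_eq_card_filter,
    ← hcard, hfilter, add_comm, ← Multiset.card_add, Multiset.filter_add_not]

variable [Finite Γ]

theorem degree_modifiedType (x : Wreath Γ n) :
    (modifiedType x).degree + (balanced x).card = n := by
  classical
  have : Finite (ConjClasses Γ) := Quotient.finite _
  have := Fintype.ofFinite (ConjClasses Γ)
  calc (modifiedType x).degree + (balanced x).card
      = ∑ y, ((Cycles.len x y : ℕ) - if Cycles.prodClass x y = 1 then 1 else 0) +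
          ∑ y, if Cycles.prodClass x y = 1 then 1 else 0 := by
        rw [PartFun.degree, finsum_eq_sum_of_fintype, balanced, Finset.card_filter]
        simp_rw [sum_modifiedType]
        rw [Finset.sum_fiberwise]
    _ = ∑ y, (Cycles.len x y : ℕ) * 1 := by
        rw [← Finset.sum_add_distrib]
        refine Finset.sum_congr rfl fun y _ => ?_
        have := (Cycles.len x y).pos
        split_ifs <;> omega
    _ = n := by
        simpa using (sum_comp_of x fun _ => 1).symm

theorem supportSize_modifiedType (x : Wreath Γ n) :
    (modifiedType x).supportSize = (supp x).card := by
  have hdegree := degree_modifiedType x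
  have hbalanced := card_modifiedType_one_add_count x
  have hpoints := card_points x 1 1
  rw [points_one_one, Finset.card_compl, Fintype.card_fin, PNat.one_coe, one_mul] at hpoints
  have hsupp := card_finset_fin_le (supp x)
  rw [PartFun.supportSize]
  omega

end Cycles

/-! ### Conjugacy and supports -/

section Conjugacy

variable {Γ : Type*} [Group Γ] {n : ℕ}

theorem mul_left_apply (x y : Wreath Γ n) (i : Fin n) :
    (x * y).left i = x.left i * y.left (x.right⁻¹ i) := rfl

theorem mul_right_apply (x y : Wreath Γ n) (i : Fin n) :
    (x * y).right i = x.right (y.right i) := rfl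

theorem pathProd_add (x : Wreath Γ n) (i : Fin n) (k l : ℕ) :
    pathProd x i (k + l) = pathProd x ((x.right ^ k) i) l * pathProd x i k := by
  induction l with
  | zero => simp [pathProd]
  | succ l ih =>
    rw [← add_assoc, pathProd, ih, pathProd, mul_assoc, add_comm k l, pow_add]
    rfl

theorem pathProd_add_cycleLen (x : Wreath Γ n) (i : Fin n) (k : ℕ) :
    pathProd x i (k + cycleLen x i) = pathProd x i k * pathProd x i (cycleLen x i) := by
  rw [add_comm, pathProd_add, pow_cycleLen]

theorem isConj_of_intertwining {x x' : Wreath Γ n} (q : Equiv.Perm (Fin n)) (u : Fin n → Γ)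
    (hright : ∀ i, q (x.right i) = x'.right (q i))
    (hleft : ∀ i, u (x.right i) * x.left i = x'.left (q i) * u i) : IsConj x x' := by
  refine isConj_iff.2 ⟨⟨fun i => u (x.right (q⁻¹ i)), q⟩, mul_inv_eq_iff_eq_mul.2 ?_⟩
  refine SemidirectProduct.ext (funext fun j => ?_) (Equiv.ext hright)
  obtain ⟨i, rfl⟩ := q.surjective j
  have hinv : q⁻¹ (x'.right⁻¹ (q i)) = x.right⁻¹ i := by
    rw [Equiv.Perm.inv_eq_iff_eq, Equiv.Perm.inv_eq_iff_eq, ← hright, Equiv.Perm.coe_inv,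
      Equiv.apply_symm_apply]
  simp only [mul_left_apply, hinv]
  simp only [Equiv.Perm.coe_inv, Equiv.symm_apply_apply, Equiv.apply_symm_apply, hleft]

theorem exists_cycles_equiv {x x' : Wreath Γ n} (h : typeOf x = typeOf x') :
    ∃ e : Cycles x ≃ Cycles x', ∀ y,
      Cycles.prodClass x' (e y) = Cycles.prodClass x y ∧ Cycles.len x' (e y) = Cycles.len x y := by
  classical
  let data {z : Wreath Γ n} (y : Cycles z) := (Cycles.prodClass z y, Cycles.len z y)
  have hfiber : ∀ p, Nonempty ({y : Cycles x // data y = p} ≃ {y : Cycles x' // data y = p}) := by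
    rintro ⟨c, k⟩
    rw [← Fintype.card_eq, Fintype.card_subtype, Fintype.card_subtype]
    simp only [data, Prod.mk.injEq, ← count_typeOf, h]
  exact ⟨Equiv.ofFiberEquiv fun p => (hfiber p).some, fun y =>
    Prod.mk.inj (Equiv.ofFiberEquiv_map (fun p => (hfiber p).some) y)⟩

theorem exists_perm_of_cycles_equiv {x x' : Wreath Γ n} (e : Cycles x ≃ Cycles x')
    (he : ∀ y, Cycles.len x' (e y) = Cycles.len x y) :
    ∃ q : Equiv.Perm (Fin n), ∀ y l, q ((x.right ^ l) y.out) = (x'.right ^ l) (e y).out := by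
  obtain ⟨q, hq⟩ := exists_lift_of_periodic (fun (y : Cycles x) l => (x'.right ^ l) (e y).out)
    fun y l => by rw [right_pow_eq_iff, ← Cycles.len_eq_cycleLen_out, he, Nat.add_modulus_modEq_iff]
  suffices hinj : Function.Injective q from
    ⟨Equiv.ofBijective q (Finite.injective_iff_bijective.1 hinj), hq⟩
  intro i j hij
  obtain ⟨y, k, rfl⟩ := exists_eq_pow_out x i
  obtain ⟨y', l, rfl⟩ := exists_eq_pow_out x j
  rw [hq, hq] at hij
  have hy : y = y' := by
    simpa only [Cycles.of_pow_apply, Cycles.of_out, e.apply_eq_iff_eq] using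
      congrArg (Cycles.of x') hij
  subst hy
  rwa [right_pow_eq_iff, ← Cycles.len_eq_cycleLen_out, he, Cycles.len_eq_cycleLen_out,
    ← right_pow_eq_iff] at hij

theorem isConj_of_typeOf_eq {x x' : Wreath Γ n} (h : typeOf x = typeOf x') : IsConj x x' := by
  obtain ⟨e, he⟩ := exists_cycles_equiv h
  obtain ⟨q, hq⟩ := exists_perm_of_cycles_equiv e fun y => (he y).2
  have hlen (y : Cycles x) : cycleLen x' (e y).out = cycleLen x y.out := by
    rw [← Cycles.len_eq_cycleLen_out, (he y).2, Cycles.len_eq_cycleLen_out]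
  have hconj (y : Cycles x) : ∃ t : Γ, t * pathProd x y.out (cycleLen x y.out) * t⁻¹ =
      pathProd x' (e y).out (cycleLen x y.out) := by
    have hclass := (he y).1
    rw [Cycles.prodClass_eq_cycleClass_out, Cycles.prodClass_eq_cycleClass_out, cycleClass,
      cycleClass, hlen, eq_comm, ConjClasses.mk_eq_mk_iff_isConj, isConj_iff] at hclass
    exact hclass
  choose t ht using hconj
  -- The conjugator along a cycle compares the products of `x'` and of `x` over initial segments.
  obtain ⟨u, hu⟩ := exists_lift_of_periodic
    (fun (y : Cycles x) l => pathProd x' (e y).out l * t y * (pathProd x y.out l)⁻¹) (by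
      intro y l
      have hpath := pathProd_add_cycleLen x' (e y).out l
      rw [hlen, ← ht] at hpath
      simp only [Cycles.len_eq_cycleLen_out, hpath, pathProd_add_cycleLen]
      group)
  have hsucc (y : Cycles x) (l : ℕ) : x.right ((x.right ^ l) y.out) = (x.right ^ (l + 1)) y.out :=
    by rw [pow_succ', Equiv.Perm.mul_apply]
  refine isConj_of_intertwining q u (fun i => ?_) fun i => ?_ <;>
    obtain ⟨y, l, rfl⟩ := exists_eq_pow_out x i
  · rw [hsucc, hq, hq, pow_succ', Equiv.Perm.mul_apply]
  · rw [hsucc, hq, hu, hu, pathProd, pathProd]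
    group

theorem isConj_of_modifiedType_eq [Finite Γ] {x x' : Wreath Γ n}
    (h : modifiedType x = modifiedType x') : IsConj x x' := by
  classical
  refine isConj_of_typeOf_eq (funext fun c => Multiset.ext.2 fun k => ?_)
  by_cases hck : c = 1 ∧ k = 1
  · have hx := card_points x 1 1
    have hx' := card_points x' 1 1
    rw [points_one_one, Finset.card_compl, ← supportSize_modifiedType, PNat.one_coe, one_mul]
      at hx hx'
    rw [hck.1, hck.2, ← hx, ← hx', h]
  · obtain ⟨k, rfl⟩ := exists_unshift_eq hck
    rw [← count_modifiedType, ← count_modifiedType, h]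

theorem mem_points_iff_of_sameCycle {m : ℕ} {x : Wreath Γ n} {y : Wreath Γ m} {e : Fin n → Fin m}
    (he : Function.Injective e) {i : Fin n}
    (hright : ∀ j, x.right.SameCycle i j → y.right (e j) = e (x.right j))
    (hleft : ∀ j, x.right.SameCycle i j → y.left (e j) = x.left j)
    (c : ConjClasses Γ) (k : ℕ+) : e i ∈ points y c k ↔ i ∈ points x c k := by
  have hcycle (k : ℕ) : x.right.SameCycle i ((x.right ^ k) i) := ⟨k, by simp⟩
  have hpow (k : ℕ) : (y.right ^ k) (e i) = e ((x.right ^ k) i) := by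
    induction k with
    | zero => rfl
    | succ k ih => simp only [pow_succ', Equiv.Perm.mul_apply, ih, hright _ (hcycle k)]
  have hpath (k : ℕ) : pathProd y (e i) k = pathProd x i k := by
    induction k with
    | zero => rfl
    | succ k ih => rw [pathProd, pathProd, ih, hpow, hleft _ (hcycle k)]
  have hlen : cycleLen y (e i) = cycleLen x i :=
    Subtype.ext <| Function.minimalPeriod_eq_minimalPeriod_iff.2 fun k => by
      simp only [Function.IsPeriodicPt, Function.IsFixedPt, ← Equiv.Perm.coe_pow, hpow, he.eq_iff]
  rw [mem_points, mem_points, cycleClass, cycleClass, hlen, hpath]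

theorem points_subset_supp (x : Wreath Γ n) {c : ConjClasses Γ} {k : ℕ+}
    (h : ¬ (c = 1 ∧ k = 1)) : points x c k ⊆ supp x := by
  intro i hi
  obtain ⟨rfl, rfl⟩ := mem_points.1 hi
  by_contra hsupp
  exact h (notMem_supp_iff_cycle.1 hsupp)

theorem right_mem_supp {x : Wreath Γ n} {i : Fin n} : x.right i ∈ supp x ↔ i ∈ supp x := by
  rw [← not_iff_not, notMem_supp, notMem_supp, x.right.injective.eq_iff]
  exact and_congr_right fun h => by rw [h]

theorem right_inv_mem_supp {x : Wreath Γ n} {i : Fin n} : x.right⁻¹ i ∈ supp x ↔ i ∈ supp x := by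
  rw [← right_mem_supp, Equiv.Perm.coe_inv, Equiv.apply_symm_apply]

theorem mem_supp_iff_of_sameCycle {x : Wreath Γ n} {i j : Fin n} (h : x.right.SameCycle i j) :
    i ∈ supp x ↔ j ∈ supp x :=
  (sameCycle_induction x (· ∈ supp x) (fun _ => propext right_mem_supp) h).to_iff

theorem right_inv_of_notMem_supp {x : Wreath Γ n} {i : Fin n} (h : i ∉ supp x) :
    x.right⁻¹ i = i := by
  rw [Equiv.Perm.inv_eq_iff_eq, (notMem_supp.1 h).1]

theorem supp_mul_subset (x y : Wreath Γ n) : supp (x * y) ⊆ supp x ∪ supp y := by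
  intro i hi
  by_contra h
  obtain ⟨hx, hy⟩ := not_or.1 (mt Finset.mem_union.2 h)
  refine mem_supp.1 hi ⟨?_, ?_⟩
  · rw [mul_right_apply, (notMem_supp.1 hy).1, (notMem_supp.1 hx).1]
  · rw [mul_left_apply, right_inv_of_notMem_supp hx, (notMem_supp.1 hy).2, (notMem_supp.1 hx).2,
      mul_one]

section Disjoint

variable {x y : Wreath Γ n} (h : Disjoint (supp x) (supp y))
include h

theorem mem_points_mul_iff_left {i : Fin n} (hi : i ∈ supp x) (c : ConjClasses Γ) (k : ℕ+) :
    i ∈ points (x * y) c k ↔ i ∈ points x c k := by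
  refine mem_points_iff_of_sameCycle (e := id) Function.injective_id (fun j hj => ?_)
    (fun j hj => ?_) c k <;> have hjx := (mem_supp_iff_of_sameCycle hj).1 hi
  · have hjy := Finset.disjoint_left.1 h hjx
    rw [id, id, mul_right_apply, (notMem_supp.1 hjy).1]
  · have hjy := Finset.disjoint_left.1 h (right_inv_mem_supp.2 hjx)
    rw [id, mul_left_apply, (notMem_supp.1 hjy).2, mul_one]

theorem mem_points_mul_iff_right {i : Fin n} (hi : i ∈ supp y) (c : ConjClasses Γ) (k : ℕ+) :
    i ∈ points (x * y) c k ↔ i ∈ points y c k := by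
  refine mem_points_iff_of_sameCycle (e := id) Function.injective_id (fun j hj => ?_)
    (fun j hj => ?_) c k <;> have hjy := (mem_supp_iff_of_sameCycle hj).1 hi
  · have hjx := Finset.disjoint_right.1 h (right_mem_supp.2 hjy)
    rw [id, id, mul_right_apply, (notMem_supp.1 hjx).1]
  · have hjx := Finset.disjoint_right.1 h hjy
    rw [id, mul_left_apply, right_inv_of_notMem_supp hjx, (notMem_supp.1 hjx).2, one_mul]

theorem points_mul_of_disjoint {c : ConjClasses Γ} {k : ℕ+} (hck : ¬ (c = 1 ∧ k = 1)) :
    points (x * y) c k = points x c k ∪ points y c k := by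
  ext i
  rw [Finset.mem_union]
  by_cases hx : i ∈ supp x
  · have hy := mt (@points_subset_supp _ _ _ y _ _ hck i) (Finset.disjoint_left.1 h hx)
    rw [mem_points_mul_iff_left h hx, or_iff_left hy]
  have hx' := mt (@points_subset_supp _ _ _ x _ _ hck i) hx
  rw [or_iff_right hx']
  by_cases hy : i ∈ supp y
  · rw [mem_points_mul_iff_right h hy]
  · have hxy : i ∉ supp (x * y) :=
      fun hi => (Finset.mem_union.1 (supp_mul_subset x y hi)).elim hx hy
    exact iff_of_false (mt (@points_subset_supp _ _ _ (x * y) _ _ hck i) hxy)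
      (mt (@points_subset_supp _ _ _ y _ _ hck i) hy)

theorem modifiedType_mul_of_disjoint : modifiedType (x * y) = modifiedType x + modifiedType y :=
  modifiedType_eq_add fun c k hck => by
    rw [points_mul_of_disjoint h hck, Finset.card_union_of_disjoint]
    exact h.mono (points_subset_supp x hck) (points_subset_supp y hck)

end Disjoint

end Conjugacy

/-! ### Elements of a given modified type -/

section Existence

variable {Γ : Type*} [Group Γ] {n : ℕ}

theorem cycleLen_of_isCycleOn {x : Wreath Γ n} {s : Finset (Fin n)}
    (hs : x.right.IsCycleOn (s : Set (Fin n))) {i : Fin n} (hi : i ∈ s) :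
    (cycleLen x i : ℕ) = s.card := by
  refine Nat.dvd_antisymm (Function.IsPeriodicPt.minimalPeriod_dvd ?_)
    ((hs.pow_apply_eq hi).1 (pow_cycleLen x i))
  rw [Function.IsPeriodicPt, ← Equiv.Perm.coe_pow]
  exact (hs.pow_apply_eq hi).2 dvd_rfl

theorem pathProd_of_left_eq_mulSingle {x : Wreath Γ n} {i : Fin n} {γ : Γ}
    (hx : x.left = Pi.mulSingle i γ) {k : ℕ} (hk : k < cycleLen x i) :
    pathProd x i (k + 1) = γ := by
  induction k with
  | zero => simp [pathProd, hx]
  | succ k ih =>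
    have hne : (x.right ^ (k + 1)) i ≠ i := by
      rw [Equiv.Perm.coe_pow]
      exact Function.not_isPeriodicPt_of_pos_of_lt_minimalPeriod k.succ_ne_zero hk
    rw [pathProd, ih (by omega), hx, Pi.mulSingle_eq_of_ne hne, one_mul]

theorem cycleClass_of_left_eq_mulSingle {x : Wreath Γ n} {i : Fin n} {γ : Γ}
    (hx : x.left = Pi.mulSingle i γ) : cycleClass x i = ConjClasses.mk γ := by
  have hpos := (cycleLen x i).pos
  rw [cycleClass, ← Nat.sub_add_cancel (Nat.one_le_of_lt hpos),
    pathProd_of_left_eq_mulSingle hx (Nat.sub_lt hpos one_pos)]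

theorem exists_cycle {s : Finset (Fin n)} (hs : s.Nonempty) (c : ConjClasses Γ) :
    ∃ x : Wreath Γ n, supp x ⊆ s ∧ ∀ i ∈ s, (cycleLen x i : ℕ) = s.card ∧ cycleClass x i = c := by
  classical
  obtain ⟨γ, rfl⟩ := ConjClasses.exists_rep c
  obtain ⟨σ, hσ, hσs⟩ := s.exists_cycleOn
  obtain ⟨i₀, hi₀⟩ := hs
  refine ⟨⟨Pi.mulSingle i₀ γ, σ⟩, fun i hi => ?_, fun i hi => ⟨cycleLen_of_isCycleOn hσ hi, ?_⟩⟩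
  · by_contra his
    refine mem_supp.1 hi ⟨Equiv.Perm.notMem_support.1 (mt (@hσs i) his), ?_⟩
    exact Pi.mulSingle_eq_of_ne (M := fun _ => Γ) (ne_of_mem_of_not_mem hi₀ his).symm γ
  · rw [← cycleClass_of_left_eq_mulSingle (x := ⟨Pi.mulSingle i₀ γ, σ⟩) rfl]
    exact sameCycle_induction _ _ (cycleClass_apply _) (hσ.2 hi hi₀)

open scoped Classical in
/-- The partition-valued function with a single part `k` at `c`. -/
def singlePart (c : ConjClasses Γ) (k : ℕ+) : PartFun Γ := Pi.single c {k}

theorem singlePart_self (c : ConjClasses Γ) (k : ℕ+) : singlePart c k c = {k} := by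
  classical rw [singlePart, Pi.single_eq_same]

theorem singlePart_of_ne {c d : ConjClasses Γ} (h : d ≠ c) (k : ℕ+) : singlePart c k d = 0 := by
  classical rw [singlePart, Pi.single_eq_of_ne h]

theorem unshift_injective (c : ConjClasses Γ) : Function.Injective (unshift c) := by
  intro k l h
  unfold unshift at h
  split_ifs at h
  exacts [add_right_cancel h, h]

theorem exists_modifiedType_eq_singlePart {s : Finset (Fin n)} {c : ConjClasses Γ} {k : ℕ+}
    (hs : s.card = unshift c k) :
    ∃ x : Wreath Γ n, supp x ⊆ s ∧ modifiedType x = singlePart c k := by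
  classical
  obtain ⟨x, hsupp, hx⟩ := exists_cycle (Finset.card_pos.1 (hs ▸ (unshift c k).pos)) c
  refine ⟨x, hsupp, funext fun d => Multiset.ext.2 fun l =>
    Nat.eq_of_mul_eq_mul_left (unshift d l).pos ?_⟩
  rw [← card_points_unshift]
  have hmem {i : Fin n} (hi : i ∈ points x d (unshift d l)) : i ∈ s ∧ d = c ∧ l = k := by
    have his := hsupp (points_subset_supp x (unshift_ne d l) hi)
    obtain ⟨hclass, hlen⟩ := mem_points.1 hi
    obtain rfl : d = c := hclass.symm.trans (hx i his).2
    exact ⟨his, rfl, unshift_injective d (PNat.coe_injective (by rw [← hlen, (hx i his).1, hs]))⟩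
  by_cases h : d = c ∧ l = k
  · obtain ⟨rfl, rfl⟩ := h
    have hpoints : points x d (unshift d l) = s := by
      refine Finset.Subset.antisymm (fun i hi => (hmem hi).1) fun i hi => ?_
      exact mem_points.2 ⟨(hx i hi).2, PNat.coe_injective ((hx i hi).1.trans hs)⟩
    rw [hpoints, hs, singlePart_self, Multiset.count_singleton_self, mul_one]
  · rw [Finset.eq_empty_of_forall_notMem fun i hi => h (hmem hi).2, Finset.card_empty, eq_comm,
      mul_eq_zero_iff_left (unshift d l).ne_zero]
    by_cases hd : d = c
    · subst hd
      rw [singlePart_self, Multiset.count_singleton, if_neg fun hl => h ⟨rfl, hl⟩]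
    · rw [singlePart_of_ne hd, Multiset.count_zero]

theorem supportSize_singlePart (c : ConjClasses Γ) (k : ℕ+) :
    (singlePart c k).supportSize = unshift c k := by
  have hdegree : (singlePart c k).degree = k := by
    rw [PartFun.degree, finsum_eq_single _ c fun d hd => by rw [singlePart_of_ne hd]; rfl,
      singlePart_self, Multiset.map_singleton, Multiset.sum_singleton]
  rw [PartFun.supportSize, hdegree, unshift]
  split_ifs with hc
  · rw [hc, singlePart_self, Multiset.card_singleton, PNat.add_coe, PNat.one_coe]
  · rw [singlePart_of_ne (Ne.symm hc), Multiset.card_zero, add_zero]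

theorem modifiedType_one : modifiedType (1 : Wreath Γ n) = 0 := by
  refine add_eq_left.1 ((modifiedType_mul_of_disjoint (x := 1) (y := 1) ?_).symm.trans ?_)
  · exact Finset.disjoint_left.2 fun i hi => absurd ⟨rfl, rfl⟩ (mem_supp.1 hi)
  · rw [one_mul]

theorem exists_eq_add_singlePart {μ : PartFun Γ} (h : μ ≠ 0) :
    ∃ ν c k, μ = ν + singlePart c k := by
  classical
  obtain ⟨c, hc⟩ := Function.ne_iff.1 h
  obtain ⟨k, hk⟩ := Multiset.exists_mem_of_ne_zero hc
  refine ⟨Function.update μ c ((μ c).erase k), c, k, funext fun d => ?_⟩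
  by_cases hd : d = c
  · rw [hd, Pi.add_apply, Function.update_self, singlePart_self, add_comm,
      Multiset.singleton_add, Multiset.cons_erase hk]
  · rw [Pi.add_apply, Function.update_of_ne hd, singlePart_of_ne hd, add_zero]

variable [Finite Γ]

theorem degree_add (μ ν : PartFun Γ) : (μ + ν).degree = μ.degree + ν.degree := by
  have : Finite (ConjClasses Γ) := Quotient.finite _
  simp only [PartFun.degree, Pi.add_apply, Multiset.map_add, Multiset.sum_add,
    finsum_add_distrib (Set.toFinite _) (Set.toFinite _)]

theorem supportSize_add (μ ν : PartFun Γ) :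
    (μ + ν).supportSize = μ.supportSize + ν.supportSize := by
  simp only [PartFun.supportSize, degree_add, Pi.add_apply, Multiset.card_add]
  omega

theorem exists_modifiedType_eq (μ : PartFun Γ) (h : μ.supportSize ≤ n) :
    ∃ x : Wreath Γ n, modifiedType x = μ := by
  induction hN : μ.supportSize using Nat.strong_induction_on generalizing μ with
  | _ N ih =>
    by_cases hμ : μ = 0
    · exact ⟨1, by rw [modifiedType_one, hμ]⟩
    obtain ⟨ν, c, k, rfl⟩ := exists_eq_add_singlePart hμ
    rw [supportSize_add, supportSize_singlePart] at h hN
    have hpos := (unshift c k).pos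
    obtain ⟨x, rfl⟩ := ih ν.supportSize (by omega) ν (by omega) rfl
    obtain ⟨s, hs, hcard⟩ : ∃ s ⊆ (supp x)ᶜ, s.card = unshift c k := by
      refine Finset.exists_subset_card_eq ?_
      rw [Finset.card_compl, Fintype.card_fin, ← supportSize_modifiedType]
      omega
    obtain ⟨y, hys, hy⟩ := exists_modifiedType_eq_singlePart hcard
    refine ⟨x * y, ?_⟩
    rw [modifiedType_mul_of_disjoint, hy]
    exact (Finset.disjoint_of_subset_left (hys.trans hs) disjoint_compl_left).symm

theorem finite_supportSize_le (N : ℕ) : {μ : PartFun Γ | μ.supportSize ≤ N}.Finite :=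
  (Set.finite_range (modifiedType : Wreath Γ N → PartFun Γ)).subset exists_modifiedType_eq

end Existence

/-! ### Enlarging the set of points -/

section Extend

variable {Γ : Type*} [Group Γ] {n m : ℕ} (e : Fin n ↪ Fin m)

/-- The element of `Γ_m` that acts as `x ∈ Γ_n` on the image of `e`, and trivially elsewhere. -/
def extend (x : Wreath Γ n) : Wreath Γ m :=
  ⟨Function.extend e x.left 1, x.right.viaEmbedding e⟩

theorem extend_right_apply (x : Wreath Γ n) (i : Fin n) :
    (extend e x).right (e i) = e (x.right i) :=
  Equiv.Perm.viaEmbedding_apply _ _ _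

theorem extend_left_apply (x : Wreath Γ n) (i : Fin n) :
    (extend e x).left (e i) = x.left i :=
  e.injective.extend_apply _ _ _

theorem extend_right_of_notMem (x : Wreath Γ n) {j : Fin m} (hj : j ∉ Set.range e) :
    (extend e x).right j = j :=
  Equiv.Perm.viaEmbedding_apply_of_notMem _ _ _ hj

theorem extend_left_of_notMem (x : Wreath Γ n) {j : Fin m} (hj : j ∉ Set.range e) :
    (extend e x).left j = 1 :=
  Function.extend_apply' _ _ _ hj

theorem eq_extend {x : Wreath Γ n} {y : Wreath Γ m} (hright : ∀ i, y.right (e i) = e (x.right i))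
    (hleft : ∀ i, y.left (e i) = x.left i) (hsupp : ∀ j ∈ supp y, j ∈ Set.range e) :
    y = extend e x := by
  refine SemidirectProduct.ext (funext fun j => ?_) (Equiv.ext fun j => ?_) <;>
    by_cases hj : j ∈ Set.range e
  · obtain ⟨i, rfl⟩ := hj
    rw [hleft, extend_left_apply]
  · rw [extend_left_of_notMem e x hj, (notMem_supp.1 (mt (hsupp j) hj)).2]
  · obtain ⟨i, rfl⟩ := hj
    rw [hright, extend_right_apply]
  · rw [extend_right_of_notMem e x hj, (notMem_supp.1 (mt (hsupp j) hj)).1]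

theorem supp_extend (x : Wreath Γ n) : supp (extend e x) = (supp x).map e := by
  ext j
  by_cases hj : j ∈ Set.range e
  · obtain ⟨i, rfl⟩ := hj
    rw [Finset.mem_map' e, mem_supp, mem_supp, extend_right_apply, extend_left_apply,
      e.injective.eq_iff]
  · refine iff_of_false (notMem_supp.2 ?_) fun hmap => hj ?_
    · exact ⟨extend_right_of_notMem e x hj, extend_left_of_notMem e x hj⟩
    · obtain ⟨i, -, rfl⟩ := Finset.mem_map.1 hmap
      exact ⟨i, rfl⟩

theorem mem_range_of_mem_supp_extend {x : Wreath Γ n} {j : Fin m} (hj : j ∈ supp (extend e x)) :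
    j ∈ Set.range e := by
  rw [supp_extend] at hj
  obtain ⟨i, -, rfl⟩ := Finset.mem_map.1 hj
  exact ⟨i, rfl⟩

theorem extend_mul (x y : Wreath Γ n) : extend e (x * y) = extend e x * extend e y := by
  refine (eq_extend e (fun i => ?_) (fun i => ?_) fun j hj => ?_).symm
  · simp only [mul_right_apply, extend_right_apply]
  · have hinv : (extend e x).right⁻¹ (e i) = e (x.right⁻¹ i) := by
      rw [Equiv.Perm.inv_eq_iff_eq, extend_right_apply, Equiv.Perm.coe_inv,
        Equiv.apply_symm_apply]
    simp only [mul_left_apply, extend_left_apply, hinv]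
  · exact (Finset.mem_union.1 (supp_mul_subset _ _ hj)).elim
      (mem_range_of_mem_supp_extend e) (mem_range_of_mem_supp_extend e)

theorem extend_injective : Function.Injective (extend (Γ := Γ) e) := by
  intro x y h
  refine SemidirectProduct.ext (funext fun i => ?_) (Equiv.ext fun i => e.injective ?_)
  · rw [← extend_left_apply e x, h, extend_left_apply]
  · rw [← extend_right_apply e x, h, extend_right_apply]

theorem exists_extend_eq {y : Wreath Γ m} (h : ∀ j ∈ supp y, j ∈ Set.range e) :
    ∃ x, extend e x = y := by
  have hrange : ∀ i, ∃ j, e j = y.right (e i) := by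
    intro i
    by_cases hi : e i ∈ supp y
    · exact h _ (right_mem_supp.2 hi)
    · exact ⟨i, (notMem_supp.1 hi).1.symm⟩
  choose p hp using hrange
  have hinj : Function.Injective p := fun i j hij => by
    rwa [← e.injective.eq_iff, hp, hp, y.right.injective.eq_iff, e.injective.eq_iff] at hij
  exact ⟨⟨fun i => y.left (e i), Equiv.ofBijective p (Finite.injective_iff_bijective.1 hinj)⟩,
    (eq_extend e (fun i => (hp i).symm) (fun _ => rfl) h).symm⟩

theorem points_extend (x : Wreath Γ n) {c : ConjClasses Γ} {k : ℕ+} (hck : ¬ (c = 1 ∧ k = 1)) :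
    points (extend e x) c k = (points x c k).map e := by
  ext j
  have hmem (i : Fin n) : e i ∈ points (extend e x) c k ↔ i ∈ points x c k :=
    mem_points_iff_of_sameCycle e.injective (fun i _ => extend_right_apply e x i)
      (fun i _ => extend_left_apply e x i) c k
  rw [Finset.mem_map]
  constructor
  · intro hj
    obtain ⟨i, rfl⟩ := mem_range_of_mem_supp_extend e (points_subset_supp _ hck hj)
    exact ⟨i, (hmem i).1 hj, rfl⟩
  · rintro ⟨i, hi, rfl⟩
    exact (hmem i).2 hi

theorem modifiedType_extend (x : Wreath Γ n) : modifiedType (extend e x) = modifiedType x :=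
  modifiedType_eq_of_card_points fun c k hck => by rw [points_extend e x hck, Finset.card_map]

end Extend

/-! ### The degree is subadditive -/

section Equations

variable {Γ ι : Type*} [Group Γ]

/-- The functions `φ : ι → Γ ∪ {0}` that solve the system `E` of monomial equations; the triple
`(i, j, a)` stands for the equation `φ j = a φ i`. -/
def solutions (E : Set (ι × ι × Γ)) : Set (ι → WithZero Γ) :=
  {φ | ∀ i j a, (i, j, a) ∈ E → φ j = a * φ i}

/-- Two indices are linked by a system of monomial equations if they lie in the same connected
component of the graph with an edge from `i` to `j` for each equation `φ j = a φ i`. -/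
def Linked (E : Set (ι × ι × Γ)) : ι → ι → Prop := Relation.EqvGen fun i j => ∃ a, (i, j, a) ∈ E

variable {E : Set (ι × ι × Γ)} {i j : ι} {a : Γ}

theorem solutions_insert :
    solutions (insert (i, j, a) E) = {φ ∈ solutions E | φ j = a * φ i} := by
  ext φ
  simp only [solutions, Set.mem_ofPred, Set.mem_insert_iff, Prod.mk.injEq]
  refine ⟨fun h => ⟨fun i j a hE => h i j a (Or.inr hE), h i j a (Or.inl ⟨rfl, rfl, rfl⟩)⟩, ?_⟩
  rintro ⟨hE, h⟩ i' j' a' (⟨rfl, rfl, rfl⟩ | h')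
  exacts [h, hE _ _ _ h']

theorem Linked.apply_eq_iff (h : Linked E i j) {φ ψ : ι → WithZero Γ} (hφ : φ ∈ solutions E)
    (hψ : ψ ∈ solutions E) : φ i = ψ i ↔ φ j = ψ j := by
  induction h with
  | rel i j hE =>
    obtain ⟨a, ha⟩ := hE
    rw [hφ i j a ha, hψ i j a ha, mul_right_inj' WithZero.coe_ne_zero]
  | refl => rfl
  | symm _ _ _ ih => exact ih.symm
  | trans _ _ _ _ _ ih ih' => exact ih.trans ih'

open scoped Classical in
theorem piecewise_mem_solutions {φ ψ : ι → WithZero Γ} (hφ : φ ∈ solutions E)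
    (hψ : ψ ∈ solutions E) (p : ι) :
    (fun k => if Linked E p k then φ k else ψ k) ∈ solutions E := by
  intro i j a hE
  have hlinked : Linked E i j := .rel i j ⟨a, hE⟩
  have hp : Linked E p j ↔ Linked E p i := ⟨(·.trans _ _ _ hlinked.symm), (·.trans _ _ _ hlinked)⟩
  simp only [hp]
  split_ifs
  exacts [hφ i j a hE, hψ i j a hE]

theorem exists_component_modification (E : Set (ι × ι × Γ)) (i j : ι) (a : Γ) :
    ∃ p, ∀ φ ∈ solutions E, ∃ φ' ∈ solutions (insert (i, j, a) E),
      ∀ k, ¬ Linked E p k → φ' k = φ k := by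
  classical
  simp only [solutions_insert]
  by_cases h : ∃ ψ ∈ solutions E, ψ j ≠ 0 ∧ ¬ Linked E j i
  · obtain ⟨ψ, hψ, hψj, hji⟩ := h
    refine ⟨j, fun φ hφ => ?_⟩
    have hscale : (fun k => ψ k * ((ψ j)⁻¹ * (a * φ i))) ∈ solutions E := fun i j b hE => by
      simp only [hψ i j b hE, mul_assoc]
    refine ⟨_, ⟨piecewise_mem_solutions hscale hφ j, ?_⟩, fun k hk => if_neg hk⟩
    rw [if_pos (show Linked E j j from .refl j), if_neg hji, mul_inv_cancel_left₀ hψj]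
  · refine ⟨i, fun φ hφ => ?_⟩
    have hzero : (fun _ => 0 : ι → WithZero Γ) ∈ solutions E := fun _ _ _ _ => (mul_zero _).symm
    refine ⟨_, ⟨piecewise_mem_solutions hzero hφ i, ?_⟩, fun k hk => if_neg hk⟩
    rw [if_pos (show Linked E i i from .refl i), mul_zero, ite_eq_left_iff]
    intro hij
    by_contra hφj
    exact h ⟨φ, hφ, hφj, fun hji => hij hji.symm⟩

instance [Finite Γ] : Finite (WithZero Γ) := inferInstanceAs (Finite (Option Γ))

variable [Finite Γ] [Finite ι]

theorem ncard_le_of_component_modification (p : ι) {T : Set (ι → WithZero Γ)}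
    (hT : ∀ φ ∈ solutions E, ∃ φ' ∈ T, ∀ k, ¬ Linked E p k → φ' k = φ k) :
    (solutions E).ncard ≤ Nat.card (WithZero Γ) * T.ncard := by
  choose! f hfT hf using hT
  rw [← Set.ncard_univ, ← Set.ncard_prod]
  refine Set.ncard_le_ncard_of_injOn (fun φ => (φ p, f φ))
    (fun φ hφ => ⟨Set.mem_univ _, hfT φ hφ⟩) (fun φ hφ ψ hψ h => funext fun k => ?_)
    (Set.toFinite _)
  obtain ⟨hp, hfφ⟩ := Prod.mk.inj h
  by_cases hk : Linked E p k
  · exact (hk.apply_eq_iff hφ hψ).1 hp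
  · rw [← hf φ hφ k hk, ← hf ψ hψ k hk, hfφ]

theorem pow_card_le_mul_ncard_solutions (E : Finset (ι × ι × Γ)) :
    Nat.card (WithZero Γ) ^ Nat.card ι ≤
      Nat.card (WithZero Γ) ^ E.card * (solutions (E : Set (ι × ι × Γ))).ncard := by
  classical
  induction E using Finset.induction_on with
  | empty =>
    have huniv : solutions (∅ : Set (ι × ι × Γ)) = Set.univ :=
      Set.eq_univ_of_forall fun _ _ _ _ h => h.elim
    rw [Finset.coe_empty, huniv, Set.ncard_univ, Nat.card_fun, Finset.card_empty, pow_zero,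
      one_mul]
  | insert e E he ih =>
    obtain ⟨p, hp⟩ := exists_component_modification (E : Set (ι × ι × Γ)) e.1 e.2.1 e.2.2
    rw [Finset.coe_insert, Finset.card_insert_of_notMem he, pow_succ, mul_assoc]
    exact ih.trans (Nat.mul_le_mul_left _ (ncard_le_of_component_modification p hp))

end Equations

section Degree

variable {Γ : Type*} [Group Γ] {n : ℕ}

/-- The functions `φ : {1, …, n} → Γ ∪ {0}` that are fixed by `x = (g, σ)`. -/
def fixed (x : Wreath Γ n) : Set (Fin n → WithZero Γ) :=
  {φ | ∀ i, φ (x.right i) = (x.left (x.right i) : WithZero Γ) * φ i}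

theorem fixed_mul_iff {x y : Wreath Γ n} {φ : Fin n → WithZero Γ} (hx : φ ∈ fixed x) :
    φ ∈ fixed (x * y) ↔ φ ∈ fixed y := by
  refine forall_congr' fun i => ?_
  rw [mul_right_apply, mul_left_apply, hx, Equiv.Perm.coe_inv, Equiv.symm_apply_apply,
    WithZero.coe_mul, mul_assoc, mul_right_inj' WithZero.coe_ne_zero]

theorem inter_fixed_subset (x y : Wreath Γ n) : fixed x ∩ fixed y ⊆ fixed (x * y) :=
  fun _ hφ => (fixed_mul_iff hφ.1).2 hφ.2

theorem single_mem_fixed {x : Wreath Γ n} {i : Fin n} :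
    (Pi.single i 1 : Fin n → WithZero Γ) ∈ fixed x ↔ i ∉ supp x := by
  rw [notMem_supp]
  constructor
  · intro h
    have hi := h i
    rw [Pi.single_eq_same, mul_one] at hi
    have hright : x.right i = i := by
      by_contra hne
      rw [Pi.single_eq_of_ne hne] at hi
      exact WithZero.coe_ne_zero hi.symm
    rw [hright, Pi.single_eq_same] at hi
    exact ⟨hright, WithZero.coe_injective hi.symm⟩
  · rintro ⟨hright, hleft⟩ j
    by_cases hj : j = i
    · rw [hj, hright, hleft, WithZero.coe_one, one_mul]
    · have hne : x.right j ≠ i := fun h => hj (x.right.injective (h.trans hright.symm))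
      rw [Pi.single_eq_of_ne hj, Pi.single_eq_of_ne hne, mul_zero]

theorem apply_pow_eq_pathProd_mul {x : Wreath Γ n} {φ : Fin n → WithZero Γ} {i : Fin n} {k : ℕ}
    (hφ : ∀ l < k, φ (x.right ((x.right ^ l) i)) =
      (x.left (x.right ((x.right ^ l) i)) : WithZero Γ) * φ ((x.right ^ l) i)) :
    φ ((x.right ^ k) i) = ((pathProd x (x.right i) k : Γ) : WithZero Γ) * φ i := by
  induction k with
  | zero => rw [pathProd, WithZero.coe_one, one_mul, pow_zero, Equiv.Perm.one_apply]
  | succ k ih =>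
    have hcomm : x.right ((x.right ^ k) i) = (x.right ^ k) (x.right i) := by
      rw [← Equiv.Perm.mul_apply, ← Equiv.Perm.mul_apply, ← pow_succ, ← pow_succ']
    rw [pow_succ', Equiv.Perm.mul_apply, hφ k k.lt_succ_self,
      ih fun l hl => hφ l (hl.trans k.lt_succ_self), pathProd, WithZero.coe_mul, mul_assoc, hcomm]

theorem cycleClass_eq_one_iff {x : Wreath Γ n} {i : Fin n} :
    cycleClass x i = 1 ↔ pathProd x (x.right i) (cycleLen x i) = 1 := by
  rw [← cycleClass_apply, cycleClass, cycleLen_apply, ConjClasses.one_eq_mk_one,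
    ConjClasses.mk_eq_mk_iff_isConj, isConj_comm, isConj_one_right]

/-- The starting points `Quotient.out` of the cycles with trivial cycle-product. -/
def balancedPoints (x : Wreath Γ n) : Finset (Fin n) :=
  (balanced x).map ⟨Quotient.out, Quotient.out_injective⟩

theorem mem_balancedPoints {x : Wreath Γ n} {i : Fin n} :
    i ∈ balancedPoints x ↔ ∃ y ∈ balanced x, y.out = i := Finset.mem_map

open scoped Classical in
/-- The equations `φ (σ i) = g_{σ i} φ i` for the points `i` outside `balancedPoints x`, where
`x = (g, σ)`. They form a spanning tree of each cycle with trivial cycle-product. -/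
def spanningEquations (x : Wreath Γ n) : Finset (Fin n × Fin n × Γ) :=
  (balancedPoints x)ᶜ.image fun i => (i, x.right i, x.left (x.right i))

theorem card_spanningEquations_le [Finite Γ] (x : Wreath Γ n) :
    (spanningEquations x).card ≤ (modifiedType x).degree := by
  classical
  refine Finset.card_image_le.trans ?_
  have hdegree := degree_modifiedType x
  rw [Finset.card_compl, Fintype.card_fin, balancedPoints, Finset.card_map]
  omega

theorem mem_fixed_of_mem_solutions {x : Wreath Γ n} {φ : Fin n → WithZero Γ}
    (hφ : φ ∈ solutions (spanningEquations x : Set (Fin n × Fin n × Γ))) : φ ∈ fixed x := by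
  classical
  have hout : ∀ i ∉ balancedPoints x, φ (x.right i) = (x.left (x.right i) : WithZero Γ) * φ i :=
    fun i hi => hφ _ _ _ (Finset.mem_image_of_mem _ (Finset.mem_compl.2 hi))
  intro i
  by_cases hi : i ∉ balancedPoints x
  · exact hout i hi
  obtain ⟨y, hy, rfl⟩ := mem_balancedPoints.1 (not_not.1 hi)
  obtain ⟨L, hL⟩ : ∃ L, (cycleLen x y.out : ℕ) = L + 1 :=
    Nat.exists_eq_add_one.2 (cycleLen x y.out).pos
  have hpath := apply_pow_eq_pathProd_mul (φ := φ) (i := x.right y.out) (k := L) fun l hl => by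
    rw [← Equiv.Perm.mul_apply (x.right ^ l), ← pow_succ]
    refine hout _ fun hmem => ?_
    obtain ⟨y', -, hy'⟩ := mem_balancedPoints.1 hmem
    obtain rfl : y' = y := by
      rw [← Cycles.of_out y', hy', Cycles.of_pow_apply, Cycles.of_out]
    have hdvd := (right_pow_eq_iff x y'.out (l + 1) 0).1 hy'.symm
    rw [Nat.modEq_zero_iff_dvd, hL] at hdvd
    exact absurd (Nat.le_of_dvd l.succ_pos hdvd) (by omega)
  have hclass : cycleClass x y.out = 1 := by
    rw [← Cycles.prodClass_eq_cycleClass_out]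
    exact mem_balanced.1 hy
  rw [cycleClass_eq_one_iff, hL, ← pathProd_apply] at hclass
  rw [← Equiv.Perm.mul_apply (x.right ^ L), ← pow_succ, ← hL, pow_cycleLen] at hpath
  rw [hpath, ← mul_assoc, ← WithZero.coe_mul, mul_eq_one_comm.1 hclass, WithZero.coe_one, one_mul]

theorem apply_eq_zero_of_mem_fixed {x : Wreath Γ n} {φ : Fin n → WithZero Γ} (hφ : φ ∈ fixed x)
    {i : Fin n} (hi : cycleClass x i ≠ 1) : φ i = 0 := by
  have hpath := apply_pow_eq_pathProd_mul (i := i) (k := cycleLen x i) fun l _ => hφ _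
  rw [pow_cycleLen] at hpath
  by_contra hne
  refine hi (cycleClass_eq_one_iff.2 (WithZero.coe_injective ?_))
  exact mul_right_cancel₀ hne (by rw [← hpath, WithZero.coe_one, one_mul])

theorem eq_of_mem_fixed {x : Wreath Γ n} {φ ψ : Fin n → WithZero Γ} (hφ : φ ∈ fixed x)
    (hψ : ψ ∈ fixed x) (h : ∀ y ∈ balanced x, φ y.out = ψ y.out) : φ = ψ := by
  funext i
  obtain ⟨y, l, rfl⟩ := exists_eq_pow_out x i
  rw [apply_pow_eq_pathProd_mul fun l _ => hφ _, apply_pow_eq_pathProd_mul fun l _ => hψ _]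
  by_cases hy : y ∈ balanced x
  · rw [h y hy]
  · rw [mem_balanced, Cycles.prodClass_eq_cycleClass_out] at hy
    rw [apply_eq_zero_of_mem_fixed hφ hy, apply_eq_zero_of_mem_fixed hψ hy]

variable [Finite Γ]

theorem ncard_fixed_le (x : Wreath Γ n) :
    (fixed x).ncard ≤ Nat.card (WithZero Γ) ^ (balanced x).card := by
  rw [← Nat.card_eq_finsetCard, ← Nat.card_fun, ← Set.ncard_univ]
  refine Set.ncard_le_ncard_of_injOn (fun φ (y : balanced x) => φ y.1.out)
    (fun _ _ => Set.mem_univ _) (fun φ hφ ψ hψ h => ?_) (Set.toFinite _)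
  exact eq_of_mem_fixed hφ hψ fun y hy => congrFun h ⟨y, hy⟩

theorem pow_le_mul_ncard_inter_fixed (x y : Wreath Γ n) :
    Nat.card (WithZero Γ) ^ n ≤ Nat.card (WithZero Γ) ^
      ((modifiedType x).degree + (modifiedType y).degree) * (fixed x ∩ fixed y).ncard := by
  classical
  have hcount := pow_card_le_mul_ncard_solutions (spanningEquations x ∪ spanningEquations y)
  rw [Nat.card_fin] at hcount
  refine hcount.trans (Nat.mul_le_mul (Nat.pow_le_pow_right Nat.card_pos ?_)
    (Set.ncard_le_ncard (fun φ hφ => ⟨?_, ?_⟩) (Set.toFinite _)))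
  · exact (Finset.card_union_le _ _).trans
      (add_le_add (card_spanningEquations_le x) (card_spanningEquations_le y))
  · exact mem_fixed_of_mem_solutions fun i j a h =>
      hφ i j a (Finset.mem_coe.2 (Finset.mem_union_left _ (Finset.mem_coe.1 h)))
  · exact mem_fixed_of_mem_solutions fun i j a h =>
      hφ i j a (Finset.mem_coe.2 (Finset.mem_union_right _ (Finset.mem_coe.1 h)))

theorem degree_mul_le (x y : Wreath Γ n) :
    (modifiedType (x * y)).degree ≤ (modifiedType x).degree + (modifiedType y).degree := by
  have hpow := (pow_le_mul_ncard_inter_fixed x y).trans (Nat.mul_le_mul_left _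
    ((Set.ncard_le_ncard (inter_fixed_subset x y) (Set.toFinite _)).trans (ncard_fixed_le _)))
  rw [← pow_add, Nat.pow_le_pow_iff_right Finite.one_lt_card] at hpow
  have hdegree := degree_modifiedType (x * y)
  omega

theorem supp_subset_of_degree_mul_eq {x y : Wreath Γ n}
    (h : (modifiedType (x * y)).degree = (modifiedType x).degree + (modifiedType y).degree) :
    supp x ⊆ supp (x * y) ∧ supp y ⊆ supp (x * y) := by
  have hpow := pow_le_mul_ncard_inter_fixed x y
  have hdegree : Nat.card (WithZero Γ) ^ n = Nat.card (WithZero Γ) ^ (modifiedType (x * y)).degree *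
      Nat.card (WithZero Γ) ^ (balanced (x * y)).card := by
    rw [← pow_add, degree_modifiedType]
  rw [← h, hdegree] at hpow
  have hfixed : fixed x ∩ fixed y = fixed (x * y) :=
    Set.eq_of_subset_of_ncard_le (inter_fixed_subset x y) ((ncard_fixed_le _).trans
      (Nat.le_of_mul_le_mul_left hpow (pow_pos Nat.card_pos _))) (Set.toFinite _)
  have hsupp (i : Fin n) (hi : i ∉ supp (x * y)) : i ∉ supp x ∧ i ∉ supp y := by
    simpa only [← hfixed, Set.mem_inter_iff, single_mem_fixed] using single_mem_fixed.2 hi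
  exact ⟨fun i hi => not_imp_not.1 (fun h => (hsupp i h).1) hi,
    fun i hi => not_imp_not.1 (fun h => (hsupp i h).2) hi⟩

end Degree

/-! ### Counting factorizations -/

section Counting

variable {Γ : Type*} [Group Γ] {n : ℕ}

theorem supp_conj (w x : Wreath Γ n) :
    supp (w * x * w⁻¹) = (supp x).map w.right.toEmbedding := by
  ext j
  obtain ⟨i, rfl⟩ := w.right.surjective j
  rw [← Equiv.toEmbedding_apply w.right i, Finset.mem_map', Equiv.toEmbedding_apply, ← not_iff_not,
    notMem_supp_iff_cycle, notMem_supp_iff_cycle, cycleLen_conj, cycleClass_conj]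

variable [Finite Γ]

open scoped Classical in
/-- The pairs `(x, y)` of elements of modified types `l` and `m` such that `x * y = z`. -/
def factorizations (l m : PartFun Γ) (z : Wreath Γ n) : Finset (Wreath Γ n × Wreath Γ n) :=
  Finset.univ.filter fun p => modifiedType p.1 = l ∧ modifiedType p.2 = m ∧ p.1 * p.2 = z

theorem mem_factorizations {l m : PartFun Γ} {z : Wreath Γ n} {p : Wreath Γ n × Wreath Γ n} :
    p ∈ factorizations l m z ↔ modifiedType p.1 = l ∧ modifiedType p.2 = m ∧ p.1 * p.2 = z := by
  classical rw [factorizations, Finset.mem_filter_univ]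

/-- The factorizations `z = x * y` with factors of modified types `l` and `m` such that `U` is
the union of the supports of `x` and `y`. -/
def exactFactorizations (l m : PartFun Γ) (z : Wreath Γ n) (U : Finset (Fin n)) :
    Finset (Wreath Γ n × Wreath Γ n) :=
  (factorizations l m z).filter fun p => supp p.1 ∪ supp p.2 = U

theorem mem_exactFactorizations {l m : PartFun Γ} {z : Wreath Γ n} {U : Finset (Fin n)}
    {p : Wreath Γ n × Wreath Γ n} : p ∈ exactFactorizations l m z U ↔
      (modifiedType p.1 = l ∧ modifiedType p.2 = m ∧ p.1 * p.2 = z) ∧ supp p.1 ∪ supp p.2 = U := by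
  rw [exactFactorizations, Finset.mem_filter, mem_factorizations]

theorem card_exactFactorizations_conj (l m : PartFun Γ) (w z : Wreath Γ n) (U : Finset (Fin n)) :
    (exactFactorizations l m (w * z * w⁻¹) (U.map w.right.toEmbedding)).card =
      (exactFactorizations l m z U).card := by
  have hmul (x y : Wreath Γ n) : w * x * w⁻¹ * (w * y * w⁻¹) = w * z * w⁻¹ ↔ x * y = z := by
    rw [conj_mul, mul_left_inj, mul_right_inj]
  refine (Finset.card_equiv (Equiv.prodCongr (MulAut.conj w).toEquiv (MulAut.conj w).toEquiv)
    fun p => ?_).symm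
  simp only [mem_exactFactorizations, Equiv.prodCongr_apply, Prod.map_fst, Prod.map_snd,
    MulEquiv.toEquiv_eq_coe, MulEquiv.coe_toEquiv, MulAut.conj_apply, hmul, modifiedType_conj,
    supp_conj, ← Finset.map_union, Finset.map_inj]

theorem card_exactFactorizations_extend {n' : ℕ} (e : Fin n ↪ Fin n') (l m : PartFun Γ)
    (z : Wreath Γ n) (U : Finset (Fin n)) :
    (exactFactorizations l m (extend e z) (U.map e)).card = (exactFactorizations l m z U).card := by
  have hiff (x y : Wreath Γ n) : (extend e x, extend e y) ∈
      exactFactorizations l m (extend e z) (U.map e) ↔ (x, y) ∈ exactFactorizations l m z U := by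
    simp only [mem_exactFactorizations, modifiedType_extend, supp_extend, ← extend_mul,
      ← Finset.map_union, (extend_injective e).eq_iff, Finset.map_inj]
  refine (Finset.card_bij (fun p _ => (extend e p.1, extend e p.2)) (fun p hp => (hiff _ _).2 hp)
    (fun p _ q _ h => ?_) ?_).symm
  · rw [Prod.mk.injEq] at h
    exact Prod.ext (extend_injective e h.1) (extend_injective e h.2)
  · rintro ⟨x, y⟩ hp
    have hrange (j : Fin n') (hj : j ∈ supp x ∪ supp y) : j ∈ Set.range e := by
      rw [(mem_exactFactorizations.1 hp).2] at hj
      obtain ⟨i, -, rfl⟩ := Finset.mem_map.1 hj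
      exact ⟨i, rfl⟩
    obtain ⟨x, rfl⟩ := exists_extend_eq e fun j hj => hrange j (Finset.mem_union_left _ hj)
    obtain ⟨y, rfl⟩ := exists_extend_eq e fun j hj => hrange j (Finset.mem_union_right _ hj)
    exact ⟨(x, y), (hiff x y).1 hp, rfl⟩

/-- An element of modified type `ν` that fixes `k` points. -/
def standardElement (ν : PartFun Γ) (k : ℕ) : Wreath Γ (ν.supportSize + k) :=
  (exists_modifiedType_eq ν (Nat.le_add_right ν.supportSize k)).choose

theorem modifiedType_standardElement (ν : PartFun Γ) (k : ℕ) :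
    modifiedType (standardElement ν k) = ν :=
  (exists_modifiedType_eq ν (Nat.le_add_right ν.supportSize k)).choose_spec

/-- The number of factorizations of a fixed element `z` of modified type `ν` into factors `x` and
`y` of modified types `l` and `m`, where the union of the supports of `x` and `y` consists of the
support of `z` and of `k` given further points. -/
def structConst (l m ν : PartFun Γ) (k : ℕ) : ℕ :=
  (exactFactorizations l m (standardElement ν k) Finset.univ).card

theorem card_exactFactorizations (l m : PartFun Γ) {z : Wreath Γ n} {U : Finset (Fin n)} {k : ℕ}
    (hU : supp z ⊆ U) (hk : U.card = (supp z).card + k) :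
    (exactFactorizations l m z U).card = structConst l m (modifiedType z) k := by
  rw [← supportSize_modifiedType] at hk
  let e : Fin ((modifiedType z).supportSize + k) ↪ Fin n := (U.orderEmbOfFin hk).toEmbedding
  have hrange : Set.range e = U := Finset.range_orderEmbOfFin U hk
  have huniv : Finset.univ.map e = U :=
    Finset.coe_injective (by rw [Finset.coe_map, Finset.coe_univ, Set.image_univ, hrange])
  obtain ⟨y, hy⟩ := exists_extend_eq e fun j hj => hrange.symm ▸ hU hj
  have htype : modifiedType (standardElement (modifiedType z) k) = modifiedType y :=
    (modifiedType_standardElement _ k).trans (by rw [← modifiedType_extend e, hy])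
  obtain ⟨w, hw⟩ := isConj_iff.1 (isConj_of_modifiedType_eq htype)
  have hstandard : (exactFactorizations l m y Finset.univ).card =
      structConst l m (modifiedType z) k := by
    rw [← hw, ← Finset.map_univ_equiv w.right, card_exactFactorizations_conj, structConst]
  rw [← hstandard, ← card_exactFactorizations_extend e, hy, huniv]

theorem exists_of_structConst_ne_zero {l m ν : PartFun Γ} {k : ℕ} (h : structConst l m ν k ≠ 0) :
    ∃ (n : ℕ) (x y : Wreath Γ n), modifiedType x = l ∧ modifiedType y = m ∧
      modifiedType (x * y) = ν ∧ (supp x ∪ supp y).card = (supp (x * y)).card + k := by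
  obtain ⟨⟨x, y⟩, hp⟩ := Finset.card_ne_zero.1 h
  obtain ⟨⟨hx, hy, hxy⟩, hsupp⟩ := mem_exactFactorizations.1 hp
  have hν : modifiedType (x * y) = ν := by rw [hxy, modifiedType_standardElement]
  refine ⟨_, x, y, hx, hy, hν, ?_⟩
  rw [hsupp, ← supportSize_modifiedType, hν, Finset.card_univ, Fintype.card_fin]

theorem supportSize_add_le_of_structConst_ne_zero {l m ν : PartFun Γ} {k : ℕ}
    (h : structConst l m ν k ≠ 0) : ν.supportSize + k ≤ l.supportSize + m.supportSize := by
  obtain ⟨n, x, y, rfl, rfl, rfl, hk⟩ := exists_of_structConst_ne_zero h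
  simp only [supportSize_modifiedType, ← hk]
  exact Finset.card_union_le _ _

theorem degree_le_of_structConst_ne_zero {l m ν : PartFun Γ} {k : ℕ}
    (h : structConst l m ν k ≠ 0) : ν.degree ≤ l.degree + m.degree := by
  obtain ⟨n, x, y, rfl, rfl, rfl, -⟩ := exists_of_structConst_ne_zero h
  exact degree_mul_le x y

theorem structConst_eq_zero_of_degree_eq {l m ν : PartFun Γ} {k : ℕ}
    (hν : ν.degree = l.degree + m.degree) (hk : k ≠ 0) : structConst l m ν k = 0 := by
  by_contra h
  obtain ⟨n, x, y, rfl, rfl, rfl, hcard⟩ := exists_of_structConst_ne_zero h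
  obtain ⟨hx, hy⟩ := supp_subset_of_degree_mul_eq hν
  have hle := Finset.card_le_card (Finset.union_subset hx hy)
  omega

theorem card_factorizations_eq_sum_exactFactorizations (l m : PartFun Γ) (z : Wreath Γ n) :
    (factorizations l m z).card =
      ∑ T ∈ (supp z)ᶜ.powerset, (exactFactorizations l m z (supp z ∪ T)).card := by
  have hmaps : ∀ p ∈ factorizations l m z,
      (supp p.1 ∪ supp p.2) \ supp z ∈ (supp z)ᶜ.powerset := fun p _ =>
    Finset.mem_powerset.2 fun i hi => Finset.mem_compl.2 (Finset.mem_sdiff.1 hi).2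
  rw [Finset.card_eq_sum_card_fiberwise hmaps]
  refine Finset.sum_congr rfl fun T hT => congrArg Finset.card (Finset.filter_congr fun p hp => ?_)
  have hsub : supp z ⊆ supp p.1 ∪ supp p.2 :=
    (mem_factorizations.1 hp).2.2 ▸ supp_mul_subset p.1 p.2
  have hdisj : Disjoint T (supp z) :=
    Finset.disjoint_left.2 fun i hi => Finset.mem_compl.1 (Finset.mem_powerset.1 hT hi)
  constructor
  · rintro rfl
    rw [Finset.union_sdiff_of_subset hsub]
  · intro h
    rw [h, Finset.union_sdiff_left, Finset.sdiff_eq_self_of_disjoint hdisj]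

theorem card_factorizations (l m : PartFun Γ) (z : Wreath Γ n) :
    (factorizations l m z).card = ∑ k ∈ Finset.range (l.supportSize + m.supportSize + 1),
      (n - (modifiedType z).supportSize).choose k * structConst l m (modifiedType z) k := by
  have hexact : ∀ T ∈ (supp z)ᶜ.powerset, (exactFactorizations l m z (supp z ∪ T)).card =
      structConst l m (modifiedType z) T.card := fun T hT =>
    card_exactFactorizations l m Finset.subset_union_left <| Finset.card_union_of_disjoint <|
      Finset.disjoint_right.2 fun i hi => Finset.mem_compl.1 (Finset.mem_powerset.1 hT hi)
  rw [card_factorizations_eq_sum_exactFactorizations, Finset.sum_congr rfl hexact,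
    Finset.sum_powerset_apply_card (structConst l m (modifiedType z)), Finset.card_compl,
    Fintype.card_fin, supportSize_modifiedType]
  simp only [smul_eq_mul]
  refine Finset.sum_congr_of_eq_on_inter (fun k _ hk => ?_) (fun k _ hk => ?_) fun _ _ _ => rfl
  · by_contra h
    have hle := supportSize_add_le_of_structConst_ne_zero (right_ne_zero_of_mul h)
    exact hk (Finset.mem_range.2 (by omega))
  · rw [Nat.choose_eq_zero_of_lt (by simpa using hk), zero_mul]

end Counting

/-! ### Binomial polynomials -/

section Polynomials

theorem intEval_eq_iff {p : intValued} {n m : ℤ} :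
    intEval p n = m ↔ (p : ℚ[X]).eval (n : ℚ) = (m : ℚ) := by
  rw [intEval_spec, Int.cast_inj]

/-- Evaluation at an integer, as a ring homomorphism on the ring of integer-valued polynomials. -/
def intEvalHom (n : ℤ) : intValued →+* ℤ where
  toFun p := intEval p n
  map_zero' := by
    rw [intEval_eq_iff, ZeroMemClass.coe_zero, Polynomial.eval_zero, Int.cast_zero]
  map_one' := by
    rw [intEval_eq_iff, OneMemClass.coe_one, Polynomial.eval_one, Int.cast_one]
  map_add' p q := by
    rw [intEval_eq_iff, Subring.coe_add, Polynomial.eval_add, intEval_spec, intEval_spec,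
      Int.cast_add]
  map_mul' p q := by
    rw [intEval_eq_iff, Subring.coe_mul, Polynomial.eval_mul, intEval_spec, intEval_spec,
      Int.cast_mul]

theorem intEvalHom_apply (p : intValued) (n : ℤ) : intEvalHom n p = intEval p n := rfl

theorem eq_zero_of_intEval_eq_zero {p : intValued} {N : ℕ}
    (h : ∀ n : ℕ, N ≤ n → intEval p n = 0) : p = 0 := by
  refine Subtype.ext (Polynomial.eq_zero_of_infinite_isRoot _ ?_)
  refine ((Set.Ici_infinite N).image (f := fun n : ℕ => (n : ℚ)) Nat.cast_injective.injOn).mono ?_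
  rintro _ ⟨n, hn, rfl⟩
  exact intEval_eq_iff.1 (h n hn)

theorem eval_binomial (s k : ℕ) (n : ℤ) :
    (Polynomial.C ((k.factorial : ℚ)⁻¹) *
      (descPochhammer ℚ k).comp (Polynomial.X - Polynomial.C (s : ℚ))).eval (n : ℚ) =
        (Ring.choose (n - s) k : ℤ) := by
  have hchoose := Ring.descPochhammer_eq_factorial_smul_choose (n - s : ℤ) k
  have hcast := descPochhammer_eval_cast (R := ℚ) k (n - s)
  rw [← Polynomial.eval_eq_smeval] at hchoose
  rw [hchoose, Int.cast_sub, Int.cast_natCast, nsmul_eq_mul, Int.cast_mul, Int.cast_natCast]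
    at hcast
  rw [Polynomial.eval_mul, Polynomial.eval_C, Polynomial.eval_comp, Polynomial.eval_sub,
    Polynomial.eval_X, Polynomial.eval_C, ← hcast,
    inv_mul_cancel_left₀ (Nat.cast_ne_zero.2 k.factorial_ne_zero)]

/-- The integer-valued polynomial `binom(t - s, k)`. -/
def binomPoly (s k : ℕ) : intValued :=
  ⟨_, fun n => ⟨_, eval_binomial s k n⟩⟩

theorem intEval_binomPoly {s k n : ℕ} (h : s ≤ n) :
    intEval (binomPoly s k) n = (n - s).choose k := by
  rw [intEval_eq_iff, binomPoly, eval_binomial, ← Nat.cast_sub h, Ring.choose_natCast]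

theorem binomPoly_zero (s : ℕ) : binomPoly s 0 = 1 := by
  refine Subtype.ext ?_
  simp [binomPoly]

end Polynomials

/-! ### Structure constants of the class algebras -/

section TopPart

variable {Γ : Type*} [Group Γ] {S S' : Type*} [CommRing S] [CommRing S']
  {c : PartFun Γ → PartFun Γ → PartFun Γ →₀ S} {a : PartFun Γ → PartFun Γ → PartFun Γ →₀ ℕ}

theorem IsTopPart.map (h : IsTopPart c a) (φ : S →+* S') :
    IsTopPart (fun l m => (c l m).mapRange φ (map_zero φ)) a where
  degree_le l m ν hν := h.degree_le l m ν fun hzero => hν (by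
    rw [Finsupp.mapRange_apply, hzero, map_zero])
  degree_eq := h.degree_eq
  eq_natCast l m ν hν := by rw [Finsupp.mapRange_apply, h.eq_natCast l m ν hν, map_natCast]

theorem IsTopPart.zero_eq_single [CharZero S] (h : IsTopPart c a) {m : PartFun Γ}
    (hc : c 0 m = Finsupp.single m 1) : a 0 m = Finsupp.single m 1 := by
  classical
  ext ν
  by_cases hν : ν.degree = (0 : PartFun Γ).degree + m.degree
  · refine Nat.cast_injective (R := S) ?_
    rw [← h.eq_natCast 0 m ν hν, hc, Finsupp.single_apply, Finsupp.single_apply, Nat.cast_ite,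
      Nat.cast_one, Nat.cast_zero]
  · have hne : m ≠ ν := fun hm => hν (by rw [hm, degree_zero, zero_add])
    rw [Finsupp.single_eq_of_ne' hne]
    exact not_not.1 fun ha => hν (h.degree_eq 0 m ν ha)

end TopPart

section Structure

variable {Γ : Type*} [Group Γ] [Finite Γ] {n : ℕ}

/-- The polynomial whose value at `n` is the coefficient of `K_ν(n)` in `K_l(n) K_m(n)`. -/
def structPoly (l m ν : PartFun Γ) : intValued :=
  ∑ k ∈ Finset.range (l.supportSize + m.supportSize + 1),
    (structConst l m ν k : intValued) * binomPoly ν.supportSize k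

theorem exists_structConst_ne_zero {l m ν : PartFun Γ} (h : structPoly l m ν ≠ 0) :
    ∃ k, structConst l m ν k ≠ 0 := by
  obtain ⟨k, -, hk⟩ := Finset.exists_ne_zero_of_sum_ne_zero h
  exact ⟨k, fun hzero => hk (by rw [hzero, Nat.cast_zero, zero_mul])⟩

theorem structPoly_of_degree_eq {l m ν : PartFun Γ} (h : ν.degree = l.degree + m.degree) :
    structPoly l m ν = (structConst l m ν 0 : intValued) := by
  rw [structPoly, Finset.sum_eq_single_of_mem 0 (Finset.mem_range.2 (Nat.succ_pos _)),
    binomPoly_zero, mul_one]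
  intro k _ hk
  rw [structConst_eq_zero_of_degree_eq h hk, Nat.cast_zero, zero_mul]

theorem supportSize_modifiedType_le (z : Wreath Γ n) : (modifiedType z).supportSize ≤ n := by
  rw [supportSize_modifiedType]
  exact (Finset.card_le_univ _).trans_eq (Fintype.card_fin n)

theorem intEval_structPoly (l m : PartFun Γ) (z : Wreath Γ n) :
    intEval (structPoly l m (modifiedType z)) n = (factorizations l m z).card := by
  rw [card_factorizations, structPoly, ← intEvalHom_apply, map_sum, Nat.cast_sum]
  refine Finset.sum_congr rfl fun k _ => ?_
  rw [map_mul, map_natCast, intEvalHom_apply, intEval_binomPoly (supportSize_modifiedType_le z),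
    Nat.cast_mul, mul_comm]

/-- The multiplication table with the entries `structPoly l m ν`. -/
def polyTable (l m : PartFun Γ) : PartFun Γ →₀ intValued :=
  Finsupp.onFinset (finite_supportSize_le (l.supportSize + m.supportSize)).toFinset
    (structPoly l m) fun ν h => by
      obtain ⟨k, hk⟩ := exists_structConst_ne_zero h
      rw [Set.Finite.mem_toFinset]
      exact (Nat.le_add_right _ k).trans (supportSize_add_le_of_structConst_ne_zero hk)

theorem polyTable_apply (l m ν : PartFun Γ) : polyTable l m ν = structPoly l m ν := rfl

/-- The structure constants `structConst l m ν 0` of the factorizations that create no new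
points, restricted to `‖ν‖ = ‖l‖ + ‖m‖`. -/
def topTable (l m : PartFun Γ) : PartFun Γ →₀ ℕ :=
  Finsupp.onFinset (finite_supportSize_le (l.supportSize + m.supportSize)).toFinset
    (fun ν => if ν.degree = l.degree + m.degree then structConst l m ν 0 else 0) fun ν h => by
      rw [Set.Finite.mem_toFinset]
      exact supportSize_add_le_of_structConst_ne_zero (ite_ne_right_iff.1 h).2

theorem isTopPart_polyTable : IsTopPart (polyTable (Γ := Γ)) topTable where
  degree_le l m ν h := by
    obtain ⟨k, hk⟩ := exists_structConst_ne_zero h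
    exact degree_le_of_structConst_ne_zero hk
  degree_eq l m ν h := (ite_ne_right_iff.1 h).1
  eq_natCast l m ν h := by
    rw [polyTable_apply, structPoly_of_degree_eq h, topTable, Finsupp.onFinset_apply, if_pos h]

/-- The multiplication table of the class algebra of `Γ_n`. -/
def evalTable (n : ℕ) (l m : PartFun Γ) : PartFun Γ →₀ ℤ :=
  (polyTable l m).mapRange (intEvalHom n) (map_zero _)

theorem isTopPart_evalTable (n : ℕ) : IsTopPart (evalTable (Γ := Γ) n) topTable :=
  isTopPart_polyTable.map (intEvalHom n)

theorem coeff_classSum (μ : PartFun Γ) (z : Wreath Γ n) [Decidable (modifiedType z = μ)] :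
    (classSum n μ).coeff z = if modifiedType z = μ then 1 else 0 := by
  classical
  rw [classSum, MonoidAlgebra.coeff_sum, Finset.sum_apply']
  simp [MonoidAlgebra.of_apply, Finsupp.single_apply]

theorem coeff_classSum_mul (l m : PartFun Γ) (z : Wreath Γ n) :
    (classSum n l * classSum n m).coeff z = (factorizations l m z).card := by
  classical
  rw [classSum, classSum, Finset.sum_mul_sum, ← Finset.sum_product', MonoidAlgebra.coeff_sum,
    Finset.sum_apply']
  simp only [MonoidAlgebra.of_apply, MonoidAlgebra.single_mul_single, mul_one,
    MonoidAlgebra.coeff_single, Finsupp.single_apply]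
  rw [← Finset.sum_filter, Finset.sum_const, nsmul_one]
  congr 2
  ext p
  simp only [mem_factorizations, Finset.mem_filter, Finset.mem_product, Finset.mem_univ, true_and,
    and_assoc]

theorem coeff_sum_smul_K (g : PartFun Γ →₀ ℤ) (z : Wreath Γ n) :
    ((g.sum fun ν r => r • K n ν : ClassAlgebra Γ n) : MonoidAlgebra ℤ (Wreath Γ n)).coeff z =
      g (modifiedType z) := by
  classical
  rw [Finsupp.sum, AddSubmonoidClass.coe_finsetSum, MonoidAlgebra.coeff_sum, Finset.sum_apply']
  have hterm (ν : PartFun Γ) : ((g ν • K n ν : ClassAlgebra Γ n) :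
      MonoidAlgebra ℤ (Wreath Γ n)).coeff z = if modifiedType z = ν then g ν else 0 := by
    rw [Subalgebra.coe_smul, MonoidAlgebra.coeff_smul, Finsupp.smul_apply, K, coeff_classSum,
      smul_eq_mul, mul_ite, mul_one, mul_zero]
  simp only [hterm]
  rw [Finset.sum_ite_eq, ite_eq_left_iff]
  exact fun h => (Finsupp.notMem_support_iff.1 h).symm

theorem hasMulTable_K (n : ℕ) : HasMulTable (K (Γ := Γ) n) (evalTable n) := fun l m => by
  ext z
  rw [coeff_sum_smul_K, evalTable, Finsupp.mapRange_apply, intEvalHom_apply, polyTable_apply,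
    intEval_structPoly]
  exact coeff_classSum_mul l m z

theorem K_eq_zero (n : ℕ) (μ : PartFun Γ) (h : n < μ.supportSize) : K n μ = 0 := by
  classical
  refine Subtype.ext (Finset.sum_eq_zero fun x hx => absurd (supportSize_modifiedType_le x) ?_)
  rwa [(Finset.mem_filter.1 hx).2, not_le]

theorem modifiedType_eq_zero_iff {x : Wreath Γ n} : modifiedType x = 0 ↔ x = 1 := by
  refine ⟨fun h => ?_, fun h => h ▸ modifiedType_one⟩
  have hcard := supportSize_modifiedType x
  rw [h, supportSize_zero, eq_comm, Finset.card_eq_zero] at hcard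
  have hfix (i : Fin n) : x.right i = i ∧ x.left i = 1 :=
    notMem_supp.1 (hcard ▸ Finset.notMem_empty i)
  exact SemidirectProduct.ext (funext fun i => (hfix i).2) (Equiv.ext fun i => (hfix i).1)

theorem K_zero (n : ℕ) : K n (0 : PartFun Γ) = 1 := by
  classical
  refine Subtype.ext ?_
  change classSum n 0 = 1
  simp only [classSum, modifiedType_eq_zero_iff, Finset.filter_eq', Finset.mem_univ, if_true,
    Finset.sum_singleton, map_one]

theorem linearIndepOn_K (n : ℕ) :
    LinearIndepOn ℤ (K (Γ := Γ) n) {μ : PartFun Γ | μ.supportSize ≤ n} := by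
  refine linearIndepOn_iff.2 fun g hg hsum => Finsupp.ext fun μ => ?_
  by_contra hμ
  obtain ⟨z, rfl⟩ := exists_modifiedType_eq μ (hg (Finsupp.mem_support_iff.2 hμ))
  rw [Finsupp.linearCombination_apply] at hsum
  rw [← coeff_sum_smul_K, hsum] at hμ
  exact hμ rfl

theorem exists_basis_grClass_K (n : ℕ) :
    ∃ B : Module.Basis {μ : PartFun Γ // μ.supportSize ≤ n} ℤ
      (AssocGr (degFil ℤ (K (Γ := Γ) n))), ∀ μ, B μ = grClass ℤ (K n) μ :=
  exists_basis_grClass (fun μ h => K_eq_zero n μ (not_le.1 h)) (linearIndepOn_K n)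

theorem isRingFiltration_K (n : ℕ) :
    IsRingFiltration (degFil ℤ (K (Γ := Γ) n)) (filLT (degFil ℤ (K n))) :=
  isRingFiltration_degFil (hasMulTable_K n) (K_zero n) (isTopPart_evalTable n).degree_le

theorem sum_mapRange_smul_K (g : PartFun Γ →₀ intValued) (n : ℕ) :
    ((g.mapRange (intEvalHom n) (map_zero _)).sum fun ν r => r • K n ν) =
      g.sum fun ν p => intEval p n • K n ν :=
  Finsupp.sum_mapRange_index fun ν => zero_smul ℤ (K n ν)

theorem ext_of_sum_intEval_smul_K {g g' : PartFun Γ →₀ intValued}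
    (h : ∀ n : ℕ, (g.sum fun ν p => intEval p n • K n ν) =
      g'.sum fun ν p => intEval p n • K n ν) : g = g' := by
  ext1 ν
  refine sub_eq_zero.1 (eq_zero_of_intEval_eq_zero (N := ν.supportSize) fun n hn => ?_)
  obtain ⟨z, rfl⟩ := exists_modifiedType_eq ν hn
  have hcoeff := congrArg (fun x : ClassAlgebra Γ n => x.1.coeff z) (h n)
  simp only [← sum_mapRange_smul_K, coeff_sum_smul_K, Finsupp.mapRange_apply] at hcoeff
  rw [← intEvalHom_apply, map_sub, hcoeff, sub_self]

theorem polyTable_unique (f : PartFun Γ → PartFun Γ → PartFun Γ →₀ intValued) :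
    (∀ (n : ℕ) (l m : PartFun Γ),
      K n l * K n m = (f l m).sum fun ν p => intEval p n • K n ν) ↔ f = polyTable := by
  have hK (n : ℕ) (l m : PartFun Γ) :
      K n l * K n m = (polyTable l m).sum fun ν p => intEval p n • K n ν :=
    (hasMulTable_K n l m).trans (sum_mapRange_smul_K _ n)
  refine ⟨fun h => funext₂ fun l m => ext_of_sum_intEval_smul_K fun n => ?_, fun h => h ▸ hK⟩
  rw [← h, hK]

theorem polyTable_zero (m : PartFun Γ) : polyTable 0 m = Finsupp.single m 1 := by
  refine ext_of_sum_intEval_smul_K fun n => ?_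
  rw [← (polyTable_unique polyTable).2 rfl, K_zero, one_mul, ← sum_mapRange_smul_K,
    Finsupp.mapRange_single, map_one, Finsupp.sum_single_index (zero_smul ℤ (K n m)), one_smul]

end Structure

/-! ### Rings with a given multiplication table -/

section Rings

variable {Γ : Type*} [Group Γ] {S A A' : Type*} [CommRing S] [CommRing A] [Algebra S A]
  [CommRing A'] [Algebra S A']

/-- The extension of scalars of a multiplication table with entries in `ℕ`. -/
def castTable (S : Type*) [CommRing S] (a : PartFun Γ → PartFun Γ → PartFun Γ →₀ ℕ)
    (l m : PartFun Γ) : PartFun Γ →₀ S :=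
  (a l m).mapRange Nat.cast Nat.cast_zero

theorem hasMulTable_castTable_iff {b : PartFun Γ → A}
    {a : PartFun Γ → PartFun Γ → PartFun Γ →₀ ℕ} :
    HasMulTable b (castTable S a) ↔ HasMulTable b a := by
  refine forall₂_congr fun l m => ?_
  rw [castTable, Finsupp.sum_mapRange_index fun ν => zero_smul S (b ν)]
  simp only [Nat.cast_smul_eq_nsmul]

theorem castTable_zero {a : PartFun Γ → PartFun Γ → PartFun Γ →₀ ℕ} {m : PartFun Γ}
    (ha : a 0 m = Finsupp.single m 1) : castTable S a 0 m = Finsupp.single m 1 := by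
  rw [castTable, ha, Finsupp.mapRange_single, Nat.cast_one]

theorem exists_subalgebra_basis_hasMulTable {b : PartFun Γ → A}
    {c : PartFun Γ → PartFun Γ → PartFun Γ →₀ S} (hli : LinearIndependent S b) (hone : b 0 = 1)
    (hb : HasMulTable b c) :
    ∃ (B : Subalgebra S A) (L : Module.Basis (PartFun Γ) S B), HasMulTable L c := by
  have hmem (g : PartFun Γ →₀ S) : (g.sum fun ν r => r • b ν) ∈ Submodule.span S (Set.range b) :=
    Submodule.sum_mem _ fun ν _ => Submodule.smul_mem _ _ (Submodule.subset_span ⟨ν, rfl⟩)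
  have hspan_mul : Submodule.span S (Set.range b) * Submodule.span S (Set.range b) ≤
      Submodule.span S (Set.range b) := by
    rw [Submodule.span_mul_span, Submodule.span_le]
    rintro _ ⟨_, ⟨l, rfl⟩, _, ⟨m, rfl⟩, rfl⟩
    change b l * b m ∈ Submodule.span S (Set.range b)
    exact hb l m ▸ hmem (c l m)
  let B : Subalgebra S A := (Submodule.span S (Set.range b)).toSubalgebra
    (hone ▸ Submodule.subset_span ⟨0, rfl⟩)
    fun x y hx hy => hspan_mul (Submodule.mul_mem_mul hx hy)
  let L : Module.Basis (PartFun Γ) S B := Module.Basis.span hli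
  have hL (μ : PartFun Γ) : B.val (L μ) = b μ :=
    congrArg Subtype.val (Module.Basis.span_apply hli μ)
  refine ⟨B, L, fun l m => Subtype.val_injective ?_⟩
  change B.val (L l * L m) = B.val _
  rw [map_mul, hL, hL, hb l m, map_finsuppSum]
  simp only [map_smul, hL]

theorem basis_zero_eq_one {L : Module.Basis (PartFun Γ) S A}
    {c : PartFun Γ → PartFun Γ → PartFun Γ →₀ S} (hL : HasMulTable L c)
    (hc : ∀ m, c 0 m = Finsupp.single m 1) : L 0 = 1 := by
  have hmul : LinearMap.mulLeft S (L 0) = LinearMap.id := L.ext fun m => by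
    rw [LinearMap.mulLeft_apply, hL, hc, Finsupp.sum_single_index (zero_smul S (L m)), one_smul,
      LinearMap.id_apply]
  simpa using LinearMap.congr_fun hmul 1

theorem exists_algEquiv_of_hasMulTable {L : Module.Basis (PartFun Γ) S A}
    {L' : Module.Basis (PartFun Γ) S A'} {c : PartFun Γ → PartFun Γ → PartFun Γ →₀ S}
    (hL : HasMulTable L c) (hL' : HasMulTable L' c) (hc : ∀ m, c 0 m = Finsupp.single m 1) :
    ∃ e : A ≃ₐ[S] A', ∀ μ, e (L μ) = L' μ := by
  let e : A ≃ₗ[S] A' := L.equiv L' (Equiv.refl _)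
  have he (μ : PartFun Γ) : e (L μ) = L' μ := L.equiv_apply μ L' (Equiv.refl _)
  have hmul : (LinearMap.mul S A).compr₂ e.toLinearMap =
      (LinearMap.mul S A').compl₁₂ e.toLinearMap e.toLinearMap := by
    refine L.ext fun l => L.ext fun m => ?_
    simp only [LinearMap.compr₂_apply, LinearMap.compl₁₂_apply, LinearMap.mul_apply',
      LinearEquiv.coe_coe, he, hL l m, hL' l m, map_finsuppSum, map_smul]
  refine ⟨AlgEquiv.ofLinearEquiv e ?_ fun x y => ?_, he⟩
  · rw [← basis_zero_eq_one hL hc, he, basis_zero_eq_one hL' hc]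
  · exact LinearMap.congr_fun (LinearMap.congr_fun hmul x) y

theorem exists_basis_grClass_of_basis (L : Module.Basis (PartFun Γ) S A) :
    ∃ B : Module.Basis (PartFun Γ) S (AssocGr (degFil S L)), ∀ μ, B μ = grClass S L μ := by
  obtain ⟨B, hB⟩ := exists_basis_grClass (p := fun _ => True) (fun _ h => absurd trivial h)
    (L.linearIndependent.comp _ Subtype.val_injective)
  refine ⟨B.reindex (Equiv.subtypeUnivEquiv fun _ => trivial), fun μ => ?_⟩
  rw [Module.Basis.reindex_apply, hB]
  rfl

theorem map_range_lof_degFil {M : Type*} [AddCommMonoid M] [Module S M] {b : PartFun Γ → A}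
    {e : AssocGr (degFil S b) →ₗ[S] M} {t : PartFun Γ → M} (he : ∀ μ, e (grClass S b μ) = t μ)
    (d : ℕ) :
    (LinearMap.range (DirectSum.lof S ℕ (GrPiece (degFil S b)) d)).map e =
      Submodule.span S {x | ∃ μ, μ.degree = d ∧ x = t μ} := by
  rw [range_lof_degFil, Submodule.map_span, Set.image_image]
  simp only [he, Set.image, Set.mem_ofPred, eq_comm]

section TopTable

variable {c : PartFun Γ → PartFun Γ → PartFun Γ →₀ S}
  {a : PartFun Γ → PartFun Γ → PartFun Γ →₀ ℕ} {L : Module.Basis (PartFun Γ) S A}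

theorem isRingFiltration_degFil_basis (hL : HasMulTable L c) (hca : IsTopPart c a)
    (hc : ∀ m, c 0 m = Finsupp.single m 1) :
    IsRingFiltration (degFil S L) (filLT (degFil S L)) :=
  isRingFiltration_degFil hL (basis_zero_eq_one hL hc) hca.degree_le

variable [CharZero S]

theorem exists_subalgebra_int_basis_hasMulTable
    [IsRingFiltration (degFil S L) (filLT (degFil S L))] (hL : HasMulTable L c)
    (hca : IsTopPart c a) (hc : ∀ m, c 0 m = Finsupp.single m 1) :
    ∃ (G : Subalgebra ℤ (AssocGr (degFil S L))) (LG : Module.Basis (PartFun Γ) ℤ G),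
      HasMulTable LG a := by
  obtain ⟨B, hB⟩ := exists_basis_grClass_of_basis L
  have hli : LinearIndependent S (grClass S L) := funext hB ▸ B.linearIndependent
  have hinj : Function.Injective fun r : ℤ => r • (1 : S) := by
    simpa only [zsmul_one] using Int.cast_injective
  simp only [← hasMulTable_castTable_iff (S := ℤ)]
  exact exists_subalgebra_basis_hasMulTable (hli.restrict_scalars hinj)
    (grClass_zero_eq_one (basis_zero_eq_one hL hc))
    (hasMulTable_castTable_iff.2 (hasMulTable_grClass hL hca))

theorem exists_algEquiv_baseChange
    [IsRingFiltration (degFil S L) (filLT (degFil S L))] (hL : HasMulTable L c)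
    (hca : IsTopPart c a) (hc : ∀ m, c 0 m = Finsupp.single m 1) {G : Type*} [CommRing G]
    {LG : Module.Basis (PartFun Γ) ℤ G} (hG : HasMulTable LG a) :
    ∃ e : AssocGr (degFil S L) ≃ₐ[S] S ⊗[ℤ] G, ∀ μ, e (grClass S L μ) = 1 ⊗ₜ[ℤ] LG μ := by
  obtain ⟨B, hB⟩ := exists_basis_grClass_of_basis L
  have hbaseChange (μ : PartFun Γ) : LG.baseChange S μ = 1 ⊗ₜ[ℤ] LG μ :=
    Module.Basis.baseChange_apply ..
  have hmulB : HasMulTable B (castTable S a) := by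
    rw [funext hB, hasMulTable_castTable_iff]
    exact hasMulTable_grClass hL hca
  have hmulG : HasMulTable (LG.baseChange S) (castTable S a) :=
    hasMulTable_castTable_iff.2 fun l m => by
      simp only [hbaseChange, Algebra.TensorProduct.tmul_mul_tmul, mul_one, hG l m, Finsupp.sum,
        TensorProduct.tmul_sum, TensorProduct.tmul_smul]
  obtain ⟨e, he⟩ := exists_algEquiv_of_hasMulTable hmulB hmulG fun m =>
    castTable_zero (hca.zero_eq_single (hc m))
  exact ⟨e, fun μ => by rw [← hB, he, hbaseChange]⟩

end TopTable

end Rings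

section ClassAlgebras

variable {Γ : Type*} [Group Γ]

variable (Γ) in
/-- The product of the class algebras of all `Γ_n`, as an algebra over the ring of integer-valued
polynomials: `p` acts on the `n`-th factor through its value at `n`. -/
def ProdClassAlgebra : Type _ := ∀ n : ℕ, ClassAlgebra Γ n

namespace ProdClassAlgebra

instance : CommRing (ProdClassAlgebra Γ) := inferInstanceAs (CommRing (∀ n : ℕ, ClassAlgebra Γ n))

/-- The projection to the `n`-th factor. -/
def proj (n : ℕ) : ProdClassAlgebra Γ →+* ClassAlgebra Γ n :=
  Pi.evalRingHom (fun n : ℕ => ClassAlgebra Γ n) n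

theorem ext {x y : ProdClassAlgebra Γ} (h : ∀ n, proj n x = proj n y) : x = y := funext h

instance : Algebra intValued (ProdClassAlgebra Γ) := RingHom.toAlgebra (show _ →+* _ from
  RingHom.pi fun n : ℕ => (algebraMap ℤ (ClassAlgebra Γ n)).comp (intEvalHom n))

theorem proj_smul (n : ℕ) (p : intValued) (x : ProdClassAlgebra Γ) :
    proj n (p • x) = intEval p n • proj n x := by
  rw [Algebra.smul_def, map_mul, Algebra.smul_def]
  rfl

variable [Finite Γ]

/-- The sequence `(K_μ(n))_n`. -/
def K (μ : PartFun Γ) : ProdClassAlgebra Γ := fun n => FarahatHigman.K n μ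

theorem proj_sum_smul_K (n : ℕ) (g : PartFun Γ →₀ intValued) :
    proj n (g.sum fun ν p => p • K ν) = g.sum fun ν p => intEval p n • FarahatHigman.K n ν := by
  rw [map_finsuppSum]
  simp only [proj_smul]
  rfl

theorem hasMulTable_K : HasMulTable (K (Γ := Γ)) polyTable := fun l m => ext fun n => by
  rw [proj_sum_smul_K, map_mul]
  exact (polyTable_unique polyTable).2 rfl n l m

theorem linearIndependent_K : LinearIndependent intValued (K (Γ := Γ)) := by
  refine linearIndependent_iff.2 fun g hg => ext_of_sum_intEval_smul_K fun n => ?_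
  rw [← proj_sum_smul_K, ← Finsupp.linearCombination_apply, hg, map_zero, Finsupp.sum_zero_index]

end ProdClassAlgebra

theorem exists_hasMulTable_polyTable (Γ : Type u) [Group Γ] [Finite Γ] :
    ∃ (F : Type u) (_ : CommRing F) (_ : Algebra intValued F)
      (L : Module.Basis (PartFun Γ) intValued F), HasMulTable L polyTable := by
  obtain ⟨F, L, hL⟩ := exists_subalgebra_basis_hasMulTable ProdClassAlgebra.linearIndependent_K
    (ProdClassAlgebra.ext K_zero) (ProdClassAlgebra.hasMulTable_K (Γ := Γ))
  exact ⟨F, inferInstance, inferInstance, L, hL⟩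

theorem exists_hasMulTable_topTable (Γ : Type u) [Group Γ] [Finite Γ] :
    ∃ (G : Type u) (_ : CommRing G) (L : Module.Basis (PartFun Γ) ℤ G),
      HasMulTable L topTable := by
  obtain ⟨F, _, _, L, hL⟩ := exists_hasMulTable_polyTable Γ
  have := isRingFiltration_degFil_basis hL isTopPart_polyTable polyTable_zero
  obtain ⟨G, LG, hLG⟩ :=
    exists_subalgebra_int_basis_hasMulTable hL isTopPart_polyTable polyTable_zero
  exact ⟨G, inferInstance, LG, hLG⟩

end ClassAlgebras

end FarahatHigman

end

theorem mainTheorem2 (Γ : Type u) [Group Γ] [Finite Γ] :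
    -- the degree defines a ring filtration on each class algebra
    ∃ _ : ∀ n : ℕ, IsRingFiltration (degFil ℤ (K (Γ := Γ) n)) (filLT (degFil ℤ (K n))),
    -- structure constants: non-negative integers, independent of `n`
    ∃ a : PartFun Γ → PartFun Γ → PartFun Γ →₀ ℕ,
      (∀ l m ν, a l m ν ≠ 0 → ν.degree = l.degree + m.degree) ∧
      (∀ n : ℕ,
        (∃ B : Module.Basis {μ : PartFun Γ // μ.supportSize ≤ n} ℤ
            (AssocGr (degFil ℤ (K (Γ := Γ) n))),
          ∀ μ, B μ = grClass ℤ (K n) μ) ∧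
        (∀ μ : PartFun Γ, n < μ.supportSize → K n μ = 0) ∧
        HasMulTable (grClass ℤ (K (Γ := Γ) n)) a) ∧
      -- the polynomials `f` that interpolate the structure constants of the class algebras
      ∃ f : PartFun Γ → PartFun Γ → PartFun Γ →₀ intValued,
        (∀ f' : PartFun Γ → PartFun Γ → PartFun Γ →₀ intValued,
          (∀ (n : ℕ) (l m : PartFun Γ),
            K n l * K n m = (f' l m).sum fun ν p => intEval p n • K n ν) ↔ f' = f) ∧
        (∀ l m ν, l.degree + m.degree < ν.degree → f l m ν = 0) ∧
        (∀ l m ν, ν.degree = l.degree + m.degree → f l m ν = (a l m ν : intValued)) ∧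
        -- the rings with these structure constants exist
        (∃ (G : Type u) (_ : CommRing G) (L : Module.Basis (PartFun Γ) ℤ G), HasMulTable L a) ∧
        (∃ (F : Type u) (_ : CommRing F) (_ : Algebra intValued F)
          (L : Module.Basis (PartFun Γ) intValued F), HasMulTable L f) ∧
        -- the graded ring associated to the second is obtained from the first by extension
        -- of scalars
        ∀ (F : Type v) [CommRing F] [Algebra intValued F]
          (LF : Module.Basis (PartFun Γ) intValued F), HasMulTable LF f →
          ∃ _ : IsRingFiltration (degFil intValued LF) (filLT (degFil intValued LF)),
            ∀ (G : Type w) [CommRing G] (LG : Module.Basis (PartFun Γ) ℤ G), HasMulTable LG a →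
              ∃ e : AssocGr (degFil intValued LF) ≃ₐ[intValued] intValued ⊗[ℤ] G,
                (∀ μ, e (grClass intValued LF μ) = 1 ⊗ₜ[ℤ] LG μ) ∧
                -- `e` respects the gradings
                ∀ d : ℕ, (LinearMap.range (DirectSum.lof intValued ℕ
                    (GrPiece (degFil intValued LF)) d)).map e.toLinearMap =
                  Submodule.span intValued {t | ∃ μ, μ.degree = d ∧ t = 1 ⊗ₜ[ℤ] LG μ} := by
  have hK := isRingFiltration_K (Γ := Γ)
  refine ⟨hK, topTable, isTopPart_polyTable.degree_eq, fun n =>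
      ⟨exists_basis_grClass_K n, K_eq_zero n,
        hasMulTable_grClass (hasMulTable_K n) (isTopPart_evalTable n)⟩,
    polyTable, polyTable_unique,
    fun l m ν h => not_not.1 fun hne => h.not_ge (isTopPart_polyTable.degree_le l m ν hne),
    isTopPart_polyTable.eq_natCast, exists_hasMulTable_topTable Γ, exists_hasMulTable_polyTable Γ,
    fun F _ _ LF hF => ?_⟩
  have hfil := isRingFiltration_degFil_basis hF isTopPart_polyTable polyTable_zero
  refine ⟨hfil, fun G _ LG hG => ?_⟩
  obtain ⟨e, he⟩ := exists_algEquiv_baseChange hF isTopPart_polyTable polyTable_zero hG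
  exact ⟨e, he, map_range_lof_degFil he⟩
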